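/- Let $k$ be a field and let $C$ be a coassociative counital coalgebra over $k$ with comultiplication $\mu$, $\mu(c)=c_{(1)}\otimes c_{(2)}$, and counit $\epsilon$. Let $\gamma\colon k\to C$ be a coaugmentation (a homomorphism of counital coalgebras) such that $C$ is conilpotent: on the noncounital coalgebra $D=C/\gamma(k)$, for every $d\in D$ there is an integer $m\ge1$ such that the iterated comultiplication $\mu^{(m)}\colon D\to D^{\otimes m+1}$ annihilates $d$. (Such a $\gamma$ is unique.) Regard $k$ as a left $C$-comodule via the coaction $x\mapsto\gamma(x)\otimes1$, and endow the dual space $C^*=\mathrm{Hom}_k(C,k)$ with the associative algebra structure $(fg)(c)=f(c_{(2)})\,g(c_{(1)})$ with unit $\epsilon$. Every left $C$-comodule $M$ with coaction $\nu\colon M\to C\otimes_kM$ is a left $C^*$-module via the composition $C^*\otimes_kM\to C^*\otimes_kC\otimes_kM\to M$ of $\mathrm{id}\otimes\nu$ with the pairing of $C^*$ and $C$; this defines an exact $k$-linear functor $\Upsilon\colon C\text{-}\mathrm{Comod}\to C^*\text{-}\mathrm{Mod}$ from left $C$-comodules to left $C^*$-modules. Write $\mathrm{Ext}_C$ and $\mathrm{Ext}_{C^*}$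 for the Ext spaces in these two abelian categories. **Theorem.** Let $n\ge0$ be an integer such that the $k$-vector space $\mathrm{Ext}^i_C(k,k)$ is finite-dimensional for all $1\le i\le n$. Then the $k$-linear map $$\mathrm{Ext}^i_C(L,M)\longrightarrow\mathrm{Ext}^i_{C^*}(L,M)$$ induced by $\Upsilon$ is an isomorphism for all left $C$-comodules $L$ and $M$ and all $0\le i\le n$. -/

import Mathlib

open CategoryTheory CategoryTheory.Limits TensorProduct

universe u

/-! ### The dual algebra -/

/-- The dual algebra `C^* = Hom_k(C, k)` of a coalgebra `C`, with the multiplication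
`(f g)(c) = f(c₂) g(c₁)`, where `μ(c) = c₁ ⊗ c₂`. This is the opposite of Mathlib's convolution
algebra, whose multiplication is `(f * g)(c) = f(c₁) g(c₂)`. The unit is the counit of `C`. -/
abbrev DualAlgebra (k C : Type u) [Field k] [AddCommGroup C] [Module k C] [Coalgebra k C] :
    Type u :=
  (WithConv (C →ₗ[k] k))ᵐᵒᵖ

/-! ### Left comodules -/

/-- A (coassociative, counital) left comodule over a coalgebra `C` over a field `k`:
a `k`-vector space `M` with a left coaction `ν : M → C ⊗ M`. -/
structure LeftComodule (k C : Type u) [Field k] [AddCommGroup C] [Module k C]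
    [Coalgebra k C] : Type (u + 1) where
  carrier : Type u
  [addCommGroup : AddCommGroup carrier]
  [module : Module k carrier]
  /-- the left coaction -/
  coact : carrier →ₗ[k] C ⊗[k] carrier
  coassoc : (TensorProduct.assoc k C C carrier).toLinearMap ∘ₗ
      (Coalgebra.comul (R := k) (A := C)).rTensor carrier ∘ₗ coact = coact.lTensor C ∘ₗ coact
  counit_coact : (TensorProduct.lid k carrier).toLinearMap ∘ₗ
      (Coalgebra.counit (R := k) (A := C)).rTensor carrier ∘ₗ coact = LinearMap.id

namespace LeftComodule

noncomputable section

variable {k C : Type u} [Field k] [AddCommGroup C] [Module k C] [Coalgebra k C]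

instance : CoeSort (LeftComodule k C) (Type u) := ⟨LeftComodule.carrier⟩

attribute [instance] LeftComodule.addCommGroup LeftComodule.module

/-- Morphisms of left comodules: the `k`-linear maps compatible with the coactions. -/
@[ext]
structure Hom (M N : LeftComodule k C) : Type u where
  lin : M →ₗ[k] N
  comm : N.coact ∘ₗ lin = lin.lTensor C ∘ₗ M.coact

instance : Category (LeftComodule k C) where
  Hom M N := Hom M N
  id M := ⟨LinearMap.id, by simp⟩
  comp f g := ⟨g.lin ∘ₗ f.lin, by
    rw [← LinearMap.comp_assoc, g.comm, LinearMap.comp_assoc, f.comm, LinearMap.lTensor_comp,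
      LinearMap.comp_assoc]⟩

/-- The `k`-linear map underlying a morphism of comodules. -/
def lin {M N : LeftComodule k C} (f : M ⟶ N) : M →ₗ[k] N := Hom.lin f

theorem comm {M N : LeftComodule k C} (f : M ⟶ N) :
    N.coact ∘ₗ lin f = (lin f).lTensor C ∘ₗ M.coact := Hom.comm f

/-- A morphism of comodules from a `k`-linear map compatible with the coactions. -/
def mkHom {M N : LeftComodule k C} (f : M →ₗ[k] N)
    (h : N.coact ∘ₗ f = f.lTensor C ∘ₗ M.coact) : M ⟶ N := Hom.mk f h

@[simp] theorem lin_mkHom {M N : LeftComodule k C} (f : M →ₗ[k] N)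
    (h : N.coact ∘ₗ f = f.lTensor C ∘ₗ M.coact) : lin (mkHom f h) = f := rfl

@[simp] theorem lin_id (M : LeftComodule k C) : lin (𝟙 M) = LinearMap.id := rfl

@[simp] theorem lin_comp {M N P : LeftComodule k C} (f : M ⟶ N) (g : N ⟶ P) :
    lin (f ≫ g) = lin g ∘ₗ lin f := rfl

@[ext]
theorem hom_ext {M N : LeftComodule k C} {f g : M ⟶ N} (h : lin f = lin g) : f = g :=
  Hom.ext h

theorem lin_injective {M N : LeftComodule k C} :
    Function.Injective (lin : (M ⟶ N) → (M →ₗ[k] N)) := fun _ _ h => hom_ext h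

/-! ### The `k`-linear structure -/

section Linear

variable {M N : LeftComodule k C}

instance : Zero (M ⟶ N) := ⟨mkHom 0 (by simp)⟩

instance : Add (M ⟶ N) := ⟨fun f g => mkHom (lin f + lin g) (by
  rw [LinearMap.comp_add, comm, comm, LinearMap.lTensor_add, LinearMap.add_comp])⟩

instance : Neg (M ⟶ N) := ⟨fun f => mkHom (-lin f) (by
  rw [LinearMap.comp_neg, comm, LinearMap.lTensor_neg, LinearMap.neg_comp])⟩

@[simp] theorem lin_zero : lin (0 : M ⟶ N) = 0 := rfl

@[simp] theorem lin_add (f g : M ⟶ N) : lin (f + g) = lin f + lin g := rfl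

instance : AddCommGroup (M ⟶ N) where
  add_assoc f g h := hom_ext (add_assoc (lin f) (lin g) (lin h))
  zero_add f := hom_ext (zero_add (lin f))
  add_zero f := hom_ext (add_zero (lin f))
  neg_add_cancel f := hom_ext (neg_add_cancel (lin f))
  add_comm f g := hom_ext (add_comm (lin f) (lin g))
  nsmul := nsmulRec
  zsmul := zsmulRec

instance : Module k (M ⟶ N) where
  smul r f := mkHom (r • lin f) (by
    rw [LinearMap.comp_smul, comm, LinearMap.lTensor_smul, LinearMap.smul_comp])
  one_smul f := hom_ext (one_smul k (lin f))
  mul_smul r s f := hom_ext (mul_smul r s (lin f))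
  smul_zero r := hom_ext (smul_zero r)
  smul_add r f g := hom_ext (smul_add r (lin f) (lin g))
  add_smul r s f := hom_ext (add_smul r s (lin f))
  zero_smul f := hom_ext (zero_smul k (lin f))

@[simp] theorem lin_smul (r : k) (f : M ⟶ N) : lin (r • f) = r • lin f := rfl

end Linear

instance : Preadditive (LeftComodule k C) where
  add_comp _ _ _ f f' g := hom_ext (by simp [LinearMap.comp_add])
  comp_add _ _ _ f g g' := hom_ext (by simp [LinearMap.add_comp])

instance : Linear k (LeftComodule k C) where
  smul_comp _ _ _ r f g := hom_ext (by simp [LinearMap.comp_smul])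
  comp_smul _ _ _ f r g := hom_ext (by simp [LinearMap.smul_comp])

/-! ### Subcomodules and quotient comodules -/

theorem lTensor_injective {k C : Type u} [Field k] [AddCommGroup C] [Module k C] {V W : Type u}
    [AddCommGroup V] [Module k V] [AddCommGroup W] [Module k W] (ι : V →ₗ[k] W) (hι : Function.Injective ι) :
    Function.Injective (ι.lTensor C) :=
  Module.Flat.lTensor_preserves_injective_linearMap ι hι

section Sub

variable {V : Type u} [AddCommGroup V] [Module k V] (M : LeftComodule k C)

/-- The comodule structure on a subspace stable under the coaction. -/
def sub (ι : V →ₗ[k] M) (hι : Function.Injective ι) (ν : V →ₗ[k] C ⊗[k] V)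
    (h : M.coact ∘ₗ ι = ι.lTensor C ∘ₗ ν) : LeftComodule k C where
  carrier := V
  coact := ν
  coassoc := by
    have inj := lTensor_injective (C := C) _ (lTensor_injective (C := C) ι hι)
    refine LinearMap.ext fun x => inj ?_
    have h1 := LinearMap.congr_fun M.coassoc (ι x)
    have hx : ∀ y, M.coact (ι y) = ι.lTensor C (ν y) := fun y => LinearMap.congr_fun h y
    have e1 : ∀ w : C ⊗[k] V, (M.coact).lTensor C (ι.lTensor C w)
        = (ι.lTensor C).lTensor C (ν.lTensor C w) := fun w => by
      induction w using TensorProduct.induction_on with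
      | zero => simp
      | tmul c v => simp [hx]
      | add a b ha hb => simp [ha, hb]
    have e2 : ∀ w : (C ⊗[k] C) ⊗[k] V,
        (ι.lTensor C).lTensor C (TensorProduct.assoc k C C V w)
        = TensorProduct.assoc k C C M (ι.lTensor (C ⊗[k] C) w) := fun w => by
      induction w using TensorProduct.induction_on with
      | zero => simp
      | tmul c v =>
        induction c using TensorProduct.induction_on with
        | zero => simp
        | tmul a b => simp
        | add a b ha hb => simp only [TensorProduct.add_tmul, map_add, ha, hb]
      | add a b ha hb => simp only [map_add, ha, hb]
    have e3 : ∀ w : C ⊗[k] V,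
        ι.lTensor (C ⊗[k] C) ((Coalgebra.comul (R := k) (A := C)).rTensor V w)
        = (Coalgebra.comul (R := k) (A := C)).rTensor M (ι.lTensor C w) := fun w => by
      induction w using TensorProduct.induction_on with
      | zero => simp
      | tmul c v => simp
      | add a b ha hb => simp [ha, hb]
    simp only [LinearMap.comp_apply, LinearEquiv.coe_coe] at h1 ⊢
    rw [e2, e3, ← e1, ← hx, h1]
  counit_coact := by
    refine LinearMap.ext fun x => hι ?_
    have h1 := LinearMap.congr_fun M.counit_coact (ι x)
    have hx : M.coact (ι x) = ι.lTensor C (ν x) := LinearMap.congr_fun h x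
    have e : ∀ w : C ⊗[k] V,
        ι (TensorProduct.lid k V ((Coalgebra.counit (R := k) (A := C)).rTensor V w))
        = TensorProduct.lid k M
          ((Coalgebra.counit (R := k) (A := C)).rTensor M (ι.lTensor C w)) := fun w => by
      induction w using TensorProduct.induction_on with
      | zero => simp
      | tmul c v => simp
      | add a b ha hb => simp [ha, hb]
    simp only [LinearMap.comp_apply, LinearEquiv.coe_coe, LinearMap.id_apply] at h1 ⊢
    rw [e, ← hx, h1]

theorem exists_sub_coact (ι : V →ₗ[k] M) (hι : Function.Injective ι)
    (h : ∀ x, M.coact (ι x) ∈ LinearMap.range (ι.lTensor C)) :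
    ∃ ν : V →ₗ[k] C ⊗[k] V, M.coact ∘ₗ ι = ι.lTensor C ∘ₗ ν := by
  let e := LinearEquiv.ofInjective (ι.lTensor C) (lTensor_injective (C := C) ι hι)
  refine ⟨e.symm.toLinearMap ∘ₗ (M.coact ∘ₗ ι).codRestrict _ h, LinearMap.ext fun x => ?_⟩
  have := congrArg Subtype.val (e.apply_symm_apply ((M.coact ∘ₗ ι).codRestrict _ h x))
  exact this.symm

end Sub

section Quot

variable {V : Type u} [AddCommGroup V] [Module k V] (M : LeftComodule k C)

theorem coassoc_comp (π : M →ₗ[k] V) (ν : V →ₗ[k] C ⊗[k] V)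
    (h : ν ∘ₗ π = π.lTensor C ∘ₗ M.coact) :
    ((TensorProduct.assoc k C C V).toLinearMap ∘ₗ
      (Coalgebra.comul (R := k) (A := C)).rTensor V ∘ₗ ν) ∘ₗ π = (ν.lTensor C ∘ₗ ν) ∘ₗ π := by
  refine LinearMap.ext fun x => ?_
  have h1 := LinearMap.congr_fun M.coassoc x
  have hx : ∀ y, ν (π y) = π.lTensor C (M.coact y) := fun y => LinearMap.congr_fun h y
  have e1 : ∀ w : C ⊗[k] M, ν.lTensor C (π.lTensor C w)
      = (π.lTensor C).lTensor C (M.coact.lTensor C w) := fun w => by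
    induction w using TensorProduct.induction_on with
    | zero => simp
    | tmul c v => simp [hx]
    | add a b ha hb => simp [ha, hb]
  have e2 : ∀ w : (C ⊗[k] C) ⊗[k] M,
      (π.lTensor C).lTensor C (TensorProduct.assoc k C C M w)
      = TensorProduct.assoc k C C V (π.lTensor (C ⊗[k] C) w) := fun w => by
    induction w using TensorProduct.induction_on with
    | zero => simp
    | tmul c v =>
      induction c using TensorProduct.induction_on with
      | zero => simp
      | tmul a b => simp
      | add a b ha hb => simp only [TensorProduct.add_tmul, map_add, ha, hb]
    | add a b ha hb => simp only [map_add, ha, hb]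
  have e3 : ∀ w : C ⊗[k] M,
      π.lTensor (C ⊗[k] C) ((Coalgebra.comul (R := k) (A := C)).rTensor M w)
      = (Coalgebra.comul (R := k) (A := C)).rTensor V (π.lTensor C w) := fun w => by
    induction w using TensorProduct.induction_on with
    | zero => simp
    | tmul c v => simp
    | add a b ha hb => simp [ha, hb]
  simp only [LinearMap.comp_apply, LinearEquiv.coe_coe] at h1 ⊢
  rw [hx, e1, ← h1, e2, e3]

theorem counit_coact_comp (π : M →ₗ[k] V) (ν : V →ₗ[k] C ⊗[k] V)
    (h : ν ∘ₗ π = π.lTensor C ∘ₗ M.coact) :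
    ((TensorProduct.lid k V).toLinearMap ∘ₗ
      (Coalgebra.counit (R := k) (A := C)).rTensor V ∘ₗ ν) ∘ₗ π = LinearMap.id ∘ₗ π := by
  refine LinearMap.ext fun x => ?_
  have h1 := LinearMap.congr_fun M.counit_coact x
  have hx : ν (π x) = π.lTensor C (M.coact x) := LinearMap.congr_fun h x
  have e : ∀ w : C ⊗[k] M,
      π (TensorProduct.lid k M ((Coalgebra.counit (R := k) (A := C)).rTensor M w))
      = TensorProduct.lid k V
        ((Coalgebra.counit (R := k) (A := C)).rTensor V (π.lTensor C w)) := fun w => by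
    induction w using TensorProduct.induction_on with
    | zero => simp
    | tmul c v => simp
    | add a b ha hb => simp [ha, hb]
  simp only [LinearMap.comp_apply, LinearEquiv.coe_coe, LinearMap.id_apply] at h1 ⊢
  rw [hx, ← e, h1]

/-- The comodule structure on a quotient space compatible with the coaction. -/
def quot (π : M →ₗ[k] V) (hπ : Function.Surjective π) (ν : V →ₗ[k] C ⊗[k] V)
    (h : ν ∘ₗ π = π.lTensor C ∘ₗ M.coact) : LeftComodule k C where
  carrier := V
  coact := ν
  coassoc := LinearMap.ext fun x => by
    obtain ⟨x, rfl⟩ := hπ x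
    exact LinearMap.congr_fun (coassoc_comp M π ν h) x
  counit_coact := LinearMap.ext fun x => by
    obtain ⟨x, rfl⟩ := hπ x
    exact LinearMap.congr_fun (counit_coact_comp M π ν h) x

end Quot

/-! ### The category of left comodules is abelian -/

section Abelian

variable {M N : LeftComodule k C}

theorem exists_ker_coact (f : M ⟶ N) :
    ∃ ν : LinearMap.ker (lin f) →ₗ[k] C ⊗[k] LinearMap.ker (lin f),
      M.coact ∘ₗ (LinearMap.ker (lin f)).subtype
        = (LinearMap.ker (lin f)).subtype.lTensor C ∘ₗ ν := by
  refine exists_sub_coact M _ (Submodule.injective_subtype _) fun x => ?_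
  have hex := Module.Flat.lTensor_exact (M := C)
    (f := (LinearMap.ker (lin f)).subtype) (g := lin f) (fun y => by simp)
  rw [LinearMap.mem_range]
  refine (hex _).1 ?_
  have := LinearMap.congr_fun (comm f) x
  simp only [LinearMap.comp_apply] at this
  rw [Submodule.subtype_apply, ← this, LinearMap.mem_ker.1 x.2, map_zero]

/-- The kernel of a morphism of comodules. -/
def ker (f : M ⟶ N) : LeftComodule k C :=
  sub M (LinearMap.ker (lin f)).subtype (Submodule.injective_subtype _)
    (exists_ker_coact f).choose (exists_ker_coact f).choose_spec

/-- The inclusion of the kernel. -/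
def kerι (f : M ⟶ N) : ker f ⟶ M :=
  mkHom (M := ker f) (LinearMap.ker (lin f)).subtype (exists_ker_coact f).choose_spec

theorem exists_coker_coact (f : M ⟶ N) :
    ∃ ν : (N ⧸ LinearMap.range (lin f)) →ₗ[k] C ⊗[k] (N ⧸ LinearMap.range (lin f)),
      ν ∘ₗ (LinearMap.range (lin f)).mkQ
        = (LinearMap.range (lin f)).mkQ.lTensor C ∘ₗ N.coact := by
  refine ⟨Submodule.liftQ _ ((LinearMap.range (lin f)).mkQ.lTensor C ∘ₗ N.coact) ?_,
    Submodule.liftQ_mkQ _ _ _⟩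
  rintro _ ⟨x, rfl⟩
  have h := LinearMap.congr_fun (comm f) x
  simp only [LinearMap.comp_apply] at h
  rw [LinearMap.mem_ker, LinearMap.comp_apply, h, ← LinearMap.comp_apply,
    ← LinearMap.lTensor_comp, LinearMap.range_mkQ_comp, LinearMap.lTensor_zero,
    LinearMap.zero_apply]

/-- The cokernel of a morphism of comodules. -/
def coker (f : M ⟶ N) : LeftComodule k C :=
  quot N (LinearMap.range (lin f)).mkQ (Submodule.mkQ_surjective _)
    (exists_coker_coact f).choose (exists_coker_coact f).choose_spec

/-- The projection onto the cokernel. -/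
def cokerπ (f : M ⟶ N) : N ⟶ coker f :=
  mkHom (N := coker f) (LinearMap.range (lin f)).mkQ (exists_coker_coact f).choose_spec

theorem kerι_comp (f : M ⟶ N) : kerι f ≫ f = 0 :=
  hom_ext (LinearMap.comp_ker_subtype (lin f))

theorem comp_cokerπ (f : M ⟶ N) : f ≫ cokerπ f = 0 :=
  hom_ext (LinearMap.range_mkQ_comp (lin f))

theorem exists_lift {K T : LeftComodule k C} (ι : K ⟶ M) (hι : Function.Injective (lin ι))
    (g : T ⟶ M) (hg : LinearMap.range (lin g) ≤ LinearMap.range (lin ι)) :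
    ∃ l : T ⟶ K, l ≫ ι = g := by
  let e := LinearEquiv.ofInjective (lin ι) hι
  let l : T →ₗ[k] K := e.symm.toLinearMap ∘ₗ
    (lin g).codRestrict _ (fun x => hg (LinearMap.mem_range_self _ x))
  have hl : lin ι ∘ₗ l = lin g := LinearMap.ext fun x => by
    have := congrArg Subtype.val (e.apply_symm_apply ((lin g).codRestrict _
      (fun x => hg (LinearMap.mem_range_self _ x)) x))
    exact this
  refine ⟨mkHom l (LinearMap.ext fun x => lTensor_injective (C := C) _ hι ?_), hom_ext hl⟩
  rw [← LinearMap.comp_apply, ← LinearMap.comp_apply, ← LinearMap.comp_assoc, ← comm,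
    LinearMap.comp_assoc, hl, ← LinearMap.comp_assoc, ← LinearMap.lTensor_comp, hl, comm]

theorem exists_desc {Q T : LeftComodule k C} (π : M ⟶ Q) (hπ : Function.Surjective (lin π))
    (g : M ⟶ T) (hg : LinearMap.ker (lin π) ≤ LinearMap.ker (lin g)) :
    ∃ l : Q ⟶ T, π ≫ l = g := by
  let e := (lin π).quotKerEquivOfSurjective hπ
  let l : Q →ₗ[k] T := (LinearMap.ker (lin π)).liftQ (lin g) hg ∘ₗ e.symm.toLinearMap
  have he : ∀ x, e.symm (lin π x) = (LinearMap.ker (lin π)).mkQ x := fun x =>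
    (LinearEquiv.symm_apply_eq e).2 rfl
  have hl : l ∘ₗ lin π = lin g := LinearMap.ext fun x => by
    simp [l, he]
  refine ⟨mkHom l (LinearMap.ext fun x => ?_), hom_ext hl⟩
  obtain ⟨x, rfl⟩ := hπ x
  rw [← LinearMap.comp_apply, ← LinearMap.comp_apply, LinearMap.comp_assoc, hl,
    LinearMap.comp_assoc, comm π, ← LinearMap.comp_assoc, ← LinearMap.lTensor_comp, hl, comm]

theorem mono_of_injective (f : M ⟶ N) (h : Function.Injective (lin f)) : Mono f where
  right_cancellation _ _ hg := hom_ext (LinearMap.ext fun x =>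
    h (LinearMap.congr_fun (congrArg lin hg) x))

theorem epi_of_surjective (f : M ⟶ N) (h : Function.Surjective (lin f)) : Epi f where
  left_cancellation _ _ hg := hom_ext (LinearMap.ext fun y => by
    obtain ⟨x, rfl⟩ := h y
    exact LinearMap.congr_fun (congrArg lin hg) x)

theorem injective_of_mono (f : M ⟶ N) [Mono f] : Function.Injective (lin f) := by
  have h : kerι f = 0 := (cancel_mono f).1 (by rw [kerι_comp, zero_comp])
  rw [← LinearMap.ker_eq_bot, eq_bot_iff]
  intro x hx
  exact LinearMap.congr_fun (congrArg lin h) (⟨x, hx⟩ : LinearMap.ker (lin f))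

theorem surjective_of_epi (f : M ⟶ N) [Epi f] : Function.Surjective (lin f) := by
  have h : cokerπ f = 0 := (cancel_epi f).1 (by rw [comp_cokerπ, comp_zero])
  rw [← LinearMap.range_eq_top, eq_top_iff]
  intro y _
  rw [← Submodule.ker_mkQ (LinearMap.range (lin f))]
  exact LinearMap.congr_fun (congrArg lin h) y

theorem range_le_ker {K : LeftComodule k C} {ι : K ⟶ M} {f : M ⟶ N} (w : ι ≫ f = 0) :
    LinearMap.range (lin ι) ≤ LinearMap.ker (lin f) :=
  LinearMap.range_le_ker_iff.2 (congrArg lin w)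

/-- A morphism that identifies its source with the kernel of `f` is a kernel of `f`. -/
def isLimitOfExact {K : LeftComodule k C} (ι : K ⟶ M) (f : M ⟶ N) (w : ι ≫ f = 0)
    (hι : Function.Injective (lin ι)) (h : LinearMap.ker (lin f) ≤ LinearMap.range (lin ι)) :
    IsLimit (KernelFork.ofι ι w) :=
  KernelFork.IsLimit.ofι ι w
    (fun g hg => (exists_lift ι hι g ((range_le_ker hg).trans h)).choose)
    (fun g hg => (exists_lift ι hι g ((range_le_ker hg).trans h)).choose_spec)
    (fun g hg m hm => by
      have := mono_of_injective ι hι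
      rw [← cancel_mono ι, hm, (exists_lift ι hι g ((range_le_ker hg).trans h)).choose_spec])

/-- A morphism that identifies its target with the cokernel of `f` is a cokernel of `f`. -/
def isColimitOfExact {Q : LeftComodule k C} (f : M ⟶ N) (π : N ⟶ Q) (w : f ≫ π = 0)
    (hπ : Function.Surjective (lin π)) (h : LinearMap.ker (lin π) ≤ LinearMap.range (lin f)) :
    IsColimit (CokernelCofork.ofπ π w) :=
  CokernelCofork.IsColimit.ofπ π w
    (fun g hg => (exists_desc π hπ g (h.trans (range_le_ker hg))).choose)
    (fun g hg => (exists_desc π hπ g (h.trans (range_le_ker hg))).choose_spec)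
    (fun g hg m hm => by
      have := epi_of_surjective π hπ
      rw [← cancel_epi π, hm, (exists_desc π hπ g (h.trans (range_le_ker hg))).choose_spec])

instance : HasKernels (LeftComodule k C) where
  has_limit f := ⟨⟨⟨_, isLimitOfExact (kerι f) f (kerι_comp f)
    (Submodule.injective_subtype _) (Submodule.range_subtype _).ge⟩⟩⟩

instance : HasCokernels (LeftComodule k C) where
  has_colimit f := ⟨⟨⟨_, isColimitOfExact f (cokerπ f) (comp_cokerπ f)
    (Submodule.mkQ_surjective _) (Submodule.ker_mkQ _).le⟩⟩⟩

instance : IsNormalMonoCategory (LeftComodule k C) where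
  normalMonoOfMono f _ := ⟨⟨_, cokerπ f, comp_cokerπ f,
    isLimitOfExact f (cokerπ f) (comp_cokerπ f) (injective_of_mono f)
      (Submodule.ker_mkQ _).le⟩⟩

instance : IsNormalEpiCategory (LeftComodule k C) where
  normalEpiOfEpi f _ := ⟨⟨_, kerι f, kerι_comp f,
    isColimitOfExact (kerι f) f (kerι_comp f) (surjective_of_epi f)
      (Submodule.range_subtype _).ge⟩⟩

/-- The coaction on the direct sum of two comodules. -/
def prodCoact (M N : LeftComodule k C) : M × N →ₗ[k] C ⊗[k] (M × N) :=
  LinearMap.coprod ((LinearMap.inl k M N).lTensor C ∘ₗ M.coact)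
    ((LinearMap.inr k M N).lTensor C ∘ₗ N.coact)

theorem prodCoact_inl (M N : LeftComodule k C) :
    prodCoact M N ∘ₗ LinearMap.inl k M N = (LinearMap.inl k M N).lTensor C ∘ₗ M.coact :=
  LinearMap.coprod_inl _ _

theorem prodCoact_inr (M N : LeftComodule k C) :
    prodCoact M N ∘ₗ LinearMap.inr k M N = (LinearMap.inr k M N).lTensor C ∘ₗ N.coact :=
  LinearMap.coprod_inr _ _

/-- The direct sum of two comodules. -/
def prod (M N : LeftComodule k C) : LeftComodule k C where
  carrier := M × N
  coact := prodCoact M N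
  coassoc := LinearMap.prod_ext (coassoc_comp M _ _ (prodCoact_inl M N))
    (coassoc_comp N _ _ (prodCoact_inr M N))
  counit_coact := LinearMap.prod_ext (counit_coact_comp M _ _ (prodCoact_inl M N))
    (counit_coact_comp N _ _ (prodCoact_inr M N))

theorem prod_comm {M N P : LeftComodule k C} (f : M × N →ₗ[k] P) (ν : P →ₗ[k] C ⊗[k] P)
    (hl : ν ∘ₗ f ∘ₗ LinearMap.inl k M N = (f ∘ₗ LinearMap.inl k M N).lTensor C ∘ₗ M.coact)
    (hr : ν ∘ₗ f ∘ₗ LinearMap.inr k M N = (f ∘ₗ LinearMap.inr k M N).lTensor C ∘ₗ N.coact) :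
    ν ∘ₗ f = f.lTensor C ∘ₗ prodCoact M N := by
  refine LinearMap.prod_ext ?_ ?_
  · rw [LinearMap.comp_assoc, hl, LinearMap.comp_assoc, prodCoact_inl, ← LinearMap.comp_assoc,
      ← LinearMap.lTensor_comp]
  · rw [LinearMap.comp_assoc, hr, LinearMap.comp_assoc, prodCoact_inr, ← LinearMap.comp_assoc,
      ← LinearMap.lTensor_comp]

/-- The direct sum of two comodules, with its inclusions and projections. -/
def prodBicone (M N : LeftComodule k C) : BinaryBicone M N where
  pt := prod M N
  fst := mkHom (M := prod M N) (LinearMap.fst k M N) (prod_comm _ _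
    (by rw [LinearMap.fst_comp_inl]; simp) (by rw [LinearMap.fst_comp_inr]; simp))
  snd := mkHom (M := prod M N) (LinearMap.snd k M N) (prod_comm _ _
    (by rw [LinearMap.snd_comp_inl]; simp) (by rw [LinearMap.snd_comp_inr]; simp))
  inl := mkHom (N := prod M N) (LinearMap.inl k M N) (prodCoact_inl M N)
  inr := mkHom (N := prod M N) (LinearMap.inr k M N) (prodCoact_inr M N)
  inl_fst := hom_ext (LinearMap.fst_comp_inl k M N)
  inl_snd := hom_ext (LinearMap.snd_comp_inl k M N)
  inr_fst := hom_ext (LinearMap.fst_comp_inr k M N)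
  inr_snd := hom_ext (LinearMap.snd_comp_inr k M N)

instance : HasBinaryBiproducts (LeftComodule k C) where
  has_binary_biproduct M N := hasBinaryBiproduct_of_total (prodBicone M N)
    (hom_ext (LinearMap.ext fun x => by
      have h : ∀ y : M × N, ((y.1, 0) : M × N) + (0, y.2) = y := fun y => by simp
      exact h x))

variable (k C) in
/-- The zero comodule. -/
def zeroComodule : LeftComodule k C where
  carrier := PUnit
  coact := 0
  coassoc := by simp
  counit_coact := LinearMap.ext fun _ => Subsingleton.elim _ _

instance : HasZeroObject (LeftComodule k C) where
  zero := ⟨zeroComodule k C, (IsZero.iff_id_eq_zero _).2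
    (hom_ext (LinearMap.ext fun _ => rfl))⟩

instance : HasFiniteProducts (LeftComodule k C) :=
  hasFiniteProducts_of_has_binary_and_terminal

instance : Abelian (LeftComodule k C) where

instance : HasExt.{u + 1} (LeftComodule k C) := HasExt.standard _

theorem function_exact_of_exact (S : ShortComplex (LeftComodule k C)) (h : S.Exact) :
    Function.Exact (lin S.f) (lin S.g) := by
  have hw := (S.exact_iff_of_forks
    (isLimitOfExact (kerι S.g) S.g (kerι_comp S.g)
      (Submodule.injective_subtype _) (Submodule.range_subtype _).ge)
    (isColimitOfExact S.f (cokerπ S.f) (comp_cokerπ S.f)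
      (Submodule.mkQ_surjective _) (Submodule.ker_mkQ _).le)).1 h
  rw [LinearMap.exact_iff]
  refine le_antisymm (fun x hx => ?_) (range_le_ker S.zero)
  have h1 := LinearMap.congr_fun (congrArg lin hw) (⟨x, hx⟩ : LinearMap.ker (lin S.g))
  exact (Submodule.Quotient.mk_eq_zero _).1 h1

end Abelian

/-! ### The comodule inclusion functor -/

section Inclusion

/-- The action of `C^*` on a left comodule, `f m = f(m₁) m₀` where `ν(m) = m₁ ⊗ m₀ ∈ C ⊗ M`. -/
def act (M : LeftComodule k C) (f : DualAlgebra k C) : M →ₗ[k] M :=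
  (TensorProduct.lid k M).toLinearMap ∘ₗ f.unop.ofConv.rTensor M ∘ₗ M.coact

theorem act_add (M : LeftComodule k C) (f g : DualAlgebra k C) :
    M.act (f + g) = M.act f + M.act g := by
  simp only [act, MulOpposite.unop_add, WithConv.ofConv_add, LinearMap.rTensor_add,
    LinearMap.add_comp, LinearMap.comp_add]

theorem act_one (M : LeftComodule k C) : M.act 1 = LinearMap.id := M.counit_coact

theorem act_mul (M : LeftComodule k C) (f g : DualAlgebra k C) :
    M.act (f * g) = M.act f ∘ₗ M.act g := by
  let p : C →ₗ[k] k := f.unop.ofConv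
  let q : C →ₗ[k] k := g.unop.ofConv
  let T : C ⊗[k] (C ⊗[k] M) →ₗ[k] M := (TensorProduct.lid k M).toLinearMap ∘ₗ
    TensorProduct.map q ((TensorProduct.lid k M).toLinearMap ∘ₗ p.rTensor M)
  have e1 : ∀ w : C ⊗[k] M, M.act f (TensorProduct.lid k M (q.rTensor M w))
      = T (M.coact.lTensor C w) := fun w => by
    induction w using TensorProduct.induction_on with
    | zero => simp
    | tmul c v => simp [T, act, p]
    | add a b ha hb => simp only [map_add, ha, hb]
  have e2 : ∀ w : (C ⊗[k] C) ⊗[k] M, T (TensorProduct.assoc k C C M w)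
      = TensorProduct.lid k M ((LinearMap.mul' k k ∘ₗ TensorProduct.map q p).rTensor M w) :=
      fun w => by
    induction w using TensorProduct.induction_on with
    | zero => simp
    | tmul c v =>
      induction c using TensorProduct.induction_on with
      | zero => simp
      | tmul a b => simp [T, mul_smul, smul_comm (p b) (q a)]
      | add a b ha hb => simp only [TensorProduct.add_tmul, map_add, ha, hb]
    | add a b ha hb => simp only [map_add, ha, hb]
  refine LinearMap.ext fun x => ?_
  have h1 := LinearMap.congr_fun M.coassoc x
  simp only [LinearMap.comp_apply, LinearEquiv.coe_coe] at h1
  change TensorProduct.lid k M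
    ((LinearMap.mul' k k ∘ₗ TensorProduct.map q p ∘ₗ Coalgebra.comul).rTensor M (M.coact x))
    = M.act f (TensorProduct.lid k M (q.rTensor M (M.coact x)))
  rw [e1, ← h1, e2, ← LinearMap.comp_assoc, LinearMap.rTensor_comp, LinearMap.comp_apply]

/-- The left `C^*`-module structure on a left `C`-comodule. -/
instance (M : LeftComodule k C) : Module (DualAlgebra k C) M where
  smul f := M.act f
  one_smul x := LinearMap.congr_fun M.act_one x
  mul_smul f g x := LinearMap.congr_fun (M.act_mul f g) x
  smul_zero f := map_zero (M.act f)
  smul_add f := map_add (M.act f)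
  add_smul f g x := LinearMap.congr_fun (M.act_add f g) x
  zero_smul x := by
    change TensorProduct.lid k M ((0 : C →ₗ[k] k).rTensor M (M.coact x)) = 0
    simp

theorem smul_def (M : LeftComodule k C) (f : DualAlgebra k C) (x : M) : f • x = M.act f x := rfl

theorem lin_act {M N : LeftComodule k C} (φ : M ⟶ N) (f : DualAlgebra k C) :
    lin φ ∘ₗ M.act f = N.act f ∘ₗ lin φ := by
  have e : ∀ w : C ⊗[k] M, lin φ (TensorProduct.lid k M (f.unop.ofConv.rTensor M w))
      = TensorProduct.lid k N (f.unop.ofConv.rTensor N ((lin φ).lTensor C w)) := fun w => by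
    induction w using TensorProduct.induction_on with
    | zero => simp
    | tmul c v => simp
    | add a b ha hb => simp only [map_add, ha, hb]
  refine LinearMap.ext fun x => ?_
  have h := LinearMap.congr_fun (comm φ) x
  simp only [LinearMap.comp_apply] at h
  simp only [act, LinearMap.comp_apply, LinearEquiv.coe_coe]
  rw [e, h]

theorem algebraMap_smul (M : LeftComodule k C) (r : k) (x : M) :
    algebraMap k (DualAlgebra k C) r • x = r • x := by
  have h : M.act (algebraMap k (DualAlgebra k C) r) = r • M.act 1 := by
    rw [Algebra.algebraMap_eq_smul_one]
    simp only [act, MulOpposite.unop_smul, WithConv.ofConv_smul, LinearMap.rTensor_smul,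
      LinearMap.comp_smul, LinearMap.smul_comp]
  rw [smul_def, h, act_one]
  rfl

variable (k C) in
/-- The comodule inclusion functor from left `C`-comodules to left `C^*`-modules. -/
def inclusion : LeftComodule k C ⥤ ModuleCat.{u} (DualAlgebra k C) where
  obj M := ModuleCat.of (DualAlgebra k C) M
  map φ := ModuleCat.ofHom
    { toFun := lin φ
      map_add' := map_add (lin φ)
      map_smul' := fun f x => LinearMap.congr_fun (lin_act φ f) x }

instance : (inclusion k C).Additive where

instance : (inclusion k C).Linear k where
  map_smul {M N} φ r := by
    ext x
    exact (algebraMap_smul N r (lin φ x)).symm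

theorem inclusion_map_exact (S : ShortComplex (LeftComodule k C)) (h : S.Exact) :
    (S.map (inclusion k C)).Exact := by
  rw [ShortComplex.ShortExact.moduleCat_exact_iff_function_exact]
  exact function_exact_of_exact S h

instance : PreservesFiniteLimits (inclusion k C) :=
  have h : PreservesFiniteLimits (inclusion k C) ∧ PreservesFiniteColimits (inclusion k C) :=
    ((Functor.exact_tfae (inclusion k C)).out 1 3).mp inclusion_map_exact
  h.1

instance : PreservesFiniteColimits (inclusion k C) :=
  have h : PreservesFiniteLimits (inclusion k C) ∧ PreservesFiniteColimits (inclusion k C) :=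
    ((Functor.exact_tfae (inclusion k C)).out 1 3).mp inclusion_map_exact
  h.2

end Inclusion

end

end LeftComodule

/-! ### Coaugmentations and conilpotency -/

noncomputable section

variable {k C : Type u} [Field k] [AddCommGroup C] [Module k C] [Coalgebra k C]

namespace Coaugmented

theorem comul_apply_one (γ : k →ₗc[k] C) :
    Coalgebra.comul (R := k) (γ 1) = γ 1 ⊗ₜ[k] γ 1 := by
  rw [← CoalgHomClass.map_comp_comul_apply]
  simp

/-- The one-dimensional left comodule `k` over a coalgebra `C` with a coaugmentation
`γ : k → C`; its coaction is `x ↦ γ(x) ⊗ 1`. -/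
def trivialComodule (γ : k →ₗc[k] C) : LeftComodule k C where
  carrier := k
  coact := (TensorProduct.mk k C k).flip 1 ∘ₗ γ.toLinearMap
  coassoc := by
    refine LinearMap.ext_ring ?_
    simp [comul_apply_one]
  counit_coact := by
    refine LinearMap.ext_ring ?_
    simp


/-- The noncounital coalgebra `D = C / γ(k)` of a coaugmented coalgebra `(C, γ)`. -/
abbrev Reduced (γ : k →ₗc[k] C) : Type u := C ⧸ LinearMap.range γ.toLinearMap

/-- The projection `C → D`. -/
abbrev proj (γ : k →ₗc[k] C) : C →ₗ[k] Reduced γ := (LinearMap.range γ.toLinearMap).mkQ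

/-- The comultiplication `D → D ⊗ D` induced by the one of `C`. -/
def reducedComul (γ : k →ₗc[k] C) : Reduced γ →ₗ[k] Reduced γ ⊗[k] Reduced γ :=
  (LinearMap.range γ.toLinearMap).liftQ
    (TensorProduct.map (proj γ) (proj γ) ∘ₗ Coalgebra.comul) (by
      rintro _ ⟨x, rfl⟩
      have h : (TensorProduct.map (proj γ) (proj γ) ∘ₗ Coalgebra.comul) ∘ₗ γ.toLinearMap = 0 := by
        refine LinearMap.ext_ring ?_
        have h1 : proj γ (γ 1) = 0 := (Submodule.Quotient.mk_eq_zero _).2 ⟨1, rfl⟩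
        simp [comul_apply_one, -Submodule.mkQ_apply, h1]
      exact LinearMap.congr_fun h x)

/-- The identification `D = D^{⊗ 1}`. -/
def degreeOne (γ : k →ₗc[k] C) : Reduced γ ≃ₗ[k] ⨂[k]^1 (Reduced γ) :=
  (PiTensorProduct.subsingletonEquiv (R := k) (s := fun _ : Fin 1 => Reduced γ) 0).symm

/-- The iterated comultiplication `μ⁽ⁿ⁾ : D → D^{⊗ (n + 1)}`, with `μ⁽⁰⁾` the identity map
and `μ⁽ⁿ⁺¹⁾ = (μ⁽ⁿ⁾ ⊗ id) ∘ μ`. -/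
def iteratedComul (γ : k →ₗc[k] C) :
    (n : ℕ) → Reduced γ →ₗ[k] ⨂[k]^(n + 1) (Reduced γ)
  | 0 => (degreeOne γ).toLinearMap
  | n + 1 => (TensorPower.mulEquiv (R := k) (M := Reduced γ) (n := n + 1) (m := 1)).toLinearMap ∘ₗ
      TensorProduct.map (iteratedComul γ n) (degreeOne γ).toLinearMap ∘ₗ reducedComul γ

theorem iteratedComul_succ_apply (γ : k →ₗc[k] C) (n : ℕ) (d : Reduced γ) :
    iteratedComul γ (n + 1) d = TensorPower.mulEquiv (R := k) (M := Reduced γ) (n := n + 1) (m := 1)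
      (TensorProduct.map (iteratedComul γ n) (degreeOne γ).toLinearMap (reducedComul γ d)) := rfl

/-- A coaugmented coalgebra `(C, γ)` is conilpotent if every element of `D = C / γ(k)` is
annihilated by some iterated comultiplication map of `D`. -/
def IsConilpotent (γ : k →ₗc[k] C) : Prop :=
  ∀ d : Reduced γ, ∃ n : ℕ, 1 ≤ n ∧ iteratedComul γ n d = 0

end Coaugmented

end

/-!
Write `R = C^*`, and let `I` be its augmentation ideal, the functionals vanishing on `γ(1)`.

*Reduction to a vanishing statement.* The inclusion functor is fully faithful, as functionals on `C`
separate the points of `C ⊗ V`. Every comodule embeds, by its coaction, into a cofree comodule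
`C ⊗ V`, which is an injective comodule. Dimension shifting along such embeddings
(`mapExt_bijective_succ`) reduces the comparison in degree `n + 1` to the one in degree `n` and to
the vanishing of `Ext^{n+1}_R(L, C ⊗ V)` for all comodules `L`. Since `C` is conilpotent, long
products of elements of `I` kill any given element of a comodule, so that every nonzero quotient of
`L` contains a copy of the trivial module `k` (`exists_socle`). As the vanishing of `Ext^{n+1}_R` is
a lifting property (`exists_lifting_iff_ext_eq_zero`), Zorn's lemma reduces the claim to `L = k`
(`ext_eq_zero_of_trivial`).

*Finite generation of syzygies implies the vanishing.* A map between free `R`-modules of finite rank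
is the transpose of a linear map `C^r → C^s`. If the `(n+1)`-st syzygy `K ⊆ R^r` of `k` is finitely
generated, then linear duality over the field `k` shows that every map `K → C ⊗ V` extends to `R^r`
(`exists_extension_cofree`), which says that `Ext^{n+1}_R(k, C ⊗ V) = 0`.

*Syzygies are finitely generated.* Elements of `C^r` define functionals on `K ⊆ R^r`. If finitely
many elements of `K` separate the functionals of this form that are annihilated by `I`, then these
elements generate `K`: finitely generated submodules of `R^r` are closed, and conilpotency gives a
Nakayama lemma (`linearCombination_surjective_of_separating`). So it suffices that the space of such
functionals be finite-dimensional (`finiteDimensional_socle`). Such a functional is a map of modules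
`K → k`, hence gives a class in `Ext^{n+1}_R(k, k)`. The class vanishes in `Ext^{n+1}_R(k, C)`,
because the composition `K → k → C` extends to `R^r`. Hence it comes from `Ext^n_R(k, C/γ(k))`,
where the comparison is already known, and so from `Ext^{n+1}_C(k, k)`, which is finite-dimensional.
The functionals with zero class extend to maps `R^r → k`, and these also form a finite-dimensional
space.
-/

open Abelian

noncomputable section

/-! ### The pairing of the dual algebra with the coalgebra -/

namespace LeftComodule

variable {k C : Type u} [Field k] [AddCommGroup C] [Module k C] [Coalgebra k C]

/-- The value of an element of the dual algebra at an element of the coalgebra. -/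
def ev (f : DualAlgebra k C) : C →ₗ[k] k := f.unop.ofConv

/-- The element of the dual algebra given by a linear functional on the coalgebra. -/
def ofDual (φ : C →ₗ[k] k) : DualAlgebra k C := MulOpposite.op (WithConv.toConv φ)

@[simp] theorem ev_ofDual (φ : C →ₗ[k] k) : ev (ofDual φ) = φ := rfl

theorem ev_injective : Function.Injective (ev : DualAlgebra k C → (C →ₗ[k] k)) :=
  fun _ _ h => MulOpposite.unop_injective (WithConv.ofConv_injective h)

@[simp] theorem ev_add (f g : DualAlgebra k C) : ev (f + g) = ev f + ev g := rfl

@[simp] theorem ev_zero : ev (0 : DualAlgebra k C) = 0 := rfl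

@[simp] theorem ev_one : ev (1 : DualAlgebra k C) = Coalgebra.counit := rfl

theorem ev_mul (f g : DualAlgebra k C) (c : C) :
    ev (f * g) c = LinearMap.mul' k k (TensorProduct.map (ev g) (ev f) (Coalgebra.comul c)) := rfl

theorem ev_algebraMap_mul (a : k) (f : DualAlgebra k C) (c : C) :
    ev (f * algebraMap k _ a) c = a * ev f c := by
  rw [← Algebra.commutes, ← Algebra.smul_def]
  rfl

/-- The right action of the dual algebra on the coalgebra, `c ↦ c₁ f(c₂)`. -/
def ract (f : DualAlgebra k C) : C →ₗ[k] C :=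
  (TensorProduct.rid k C).toLinearMap ∘ₗ (ev f).lTensor C ∘ₗ Coalgebra.comul

theorem ev_ract (f g : DualAlgebra k C) (c : C) : ev g (ract f c) = ev (f * g) c := by
  rw [ev_mul]
  have e : ∀ w : C ⊗[k] C, ev g (TensorProduct.rid k C ((ev f).lTensor C w))
      = LinearMap.mul' k k (TensorProduct.map (ev g) (ev f) w) := fun w => by
    induction w using TensorProduct.induction_on with
    | zero => simp
    | tmul c v => simp [mul_comm]
    | add a b ha hb => simp only [map_add, ha, hb]
  exact e _

/-! ### Cofree comodules -/

variable (k C) in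
/-- The coalgebra as a left comodule over itself. -/
abbrev regular : LeftComodule k C where
  carrier := C
  coact := Coalgebra.comul
  coassoc := Coalgebra.coassoc
  counit_coact := by
    refine LinearMap.ext fun x => ?_
    have := LinearMap.congr_fun (Coalgebra.rTensor_counit_comp_comul (R := k) (A := C)) x
    simp only [LinearMap.comp_apply, LinearEquiv.coe_coe] at this ⊢
    rw [this]
    simp

theorem ev_act_regular (f g : DualAlgebra k C) (c : C) :
    ev g ((regular k C).act f c) = ev (g * f) c := by
  rw [ev_mul]
  have e : ∀ w : C ⊗[k] C, ev g (TensorProduct.lid k C ((ev f).rTensor C w))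
      = LinearMap.mul' k k (TensorProduct.map (ev f) (ev g) w) := fun w => by
    induction w using TensorProduct.induction_on with
    | zero => simp
    | tmul c v => simp
    | add a b ha hb => simp only [map_add, ha, hb]
  exact e _

/-- The cofree comodule `C ⊗ V` cogenerated by a vector space `V`. -/
abbrev cofree (V : Type u) [AddCommGroup V] [Module k V] : LeftComodule k C where
  carrier := C ⊗[k] V
  coact := (TensorProduct.assoc k C C V).toLinearMap ∘ₗ
    (Coalgebra.comul (R := k) (A := C)).rTensor V
  coassoc := by
    refine TensorProduct.ext' fun c v => ?_
    have h := Coalgebra.coassoc_apply (R := k) c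
    have e1 : ∀ w : C ⊗[k] C,
        TensorProduct.assoc k C C (C ⊗[k] V) ((Coalgebra.comul (R := k) (A := C)).rTensor _
          (TensorProduct.assoc k C C V (w ⊗ₜ[k] v)))
        = (TensorProduct.assoc k C C V).toLinearMap.lTensor C (TensorProduct.assoc k C (C ⊗[k] C) V
          ((TensorProduct.assoc k C C C
            ((Coalgebra.comul (R := k) (A := C)).rTensor C w)) ⊗ₜ[k] v)) := fun w => by
      induction w using TensorProduct.induction_on with
      | zero => simp
      | tmul a b =>
        simp only [TensorProduct.assoc_tmul, LinearMap.rTensor_tmul]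
        generalize (Coalgebra.comul (R := k) a) = y
        induction y using TensorProduct.induction_on with
        | zero => simp
        | tmul a b => simp
        | add a b ha hb => simp only [TensorProduct.add_tmul, map_add, ha, hb]
      | add a b ha hb => simp only [TensorProduct.add_tmul, map_add, ha, hb]
    have e2 : ∀ w : C ⊗[k] C,
        ((TensorProduct.assoc k C C V).toLinearMap ∘ₗ
          (Coalgebra.comul (R := k) (A := C)).rTensor V).lTensor C
            (TensorProduct.assoc k C C V (w ⊗ₜ[k] v))
        = (TensorProduct.assoc k C C V).toLinearMap.lTensor C (TensorProduct.assoc k C (C ⊗[k] C) V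
          (((Coalgebra.comul (R := k) (A := C)).lTensor C w) ⊗ₜ[k] v)) := fun w => by
      induction w using TensorProduct.induction_on with
      | zero => simp
      | tmul a b => simp
      | add a b ha hb => simp only [TensorProduct.add_tmul, map_add, ha, hb]
    simp only [LinearMap.comp_apply, LinearMap.rTensor_tmul, LinearEquiv.coe_coe]
    rw [e1, h]
    exact (e2 _).symm
  counit_coact := by
    refine TensorProduct.ext' fun c v => ?_
    have h := Coalgebra.rTensor_counit_comul (R := k) c
    have e : ∀ w : C ⊗[k] C, TensorProduct.lid k (C ⊗[k] V)
        ((Coalgebra.counit (R := k) (A := C)).rTensor _ (TensorProduct.assoc k C C V (w ⊗ₜ[k] v)))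
        = (TensorProduct.lid k C ((Coalgebra.counit (R := k) (A := C)).rTensor C w)) ⊗ₜ[k] v :=
        fun w => by
      induction w using TensorProduct.induction_on with
      | zero => simp
      | tmul a b => simp [TensorProduct.smul_tmul']
      | add a b ha hb => simp only [TensorProduct.add_tmul, map_add, ha, hb]
    simp only [LinearMap.comp_apply, LinearMap.rTensor_tmul, LinearEquiv.coe_coe]
    rw [e, h]
    simp

theorem act_cofree_tmul (V : Type u) [AddCommGroup V] [Module k V] (f : DualAlgebra k C)
    (c : C) (v : V) :
    (cofree (C := C) V).act f (c ⊗ₜ[k] v) = (regular k C).act f c ⊗ₜ[k] v := by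
  have e : ∀ w : C ⊗[k] C, TensorProduct.lid k (C ⊗[k] V)
      ((ev f).rTensor _ (TensorProduct.assoc k C C V (w ⊗ₜ[k] v)))
      = (TensorProduct.lid k C ((ev f).rTensor C w)) ⊗ₜ[k] v := fun w => by
    induction w using TensorProduct.induction_on with
    | zero => simp
    | tmul a b => simp [TensorProduct.smul_tmul']
    | add a b ha hb => simp only [TensorProduct.add_tmul, map_add, ha, hb]
  exact e _

/-- The universal property of the cofree comodule: the comodule morphism `M → C ⊗ V`
corresponding to a linear map `M → V`. -/
def toCofree (M : LeftComodule k C) {V : Type u} [AddCommGroup V] [Module k V] (φ : M →ₗ[k] V) :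
    M ⟶ cofree (C := C) V :=
  mkHom (N := cofree (C := C) V) (φ.lTensor C ∘ₗ M.coact) (by
    refine LinearMap.ext fun x => ?_
    have h := LinearMap.congr_fun M.coassoc x
    have e1 : ∀ w : C ⊗[k] M, (cofree (C := C) V).coact (φ.lTensor C w)
        = (φ.lTensor C).lTensor C (TensorProduct.assoc k C C M
          ((Coalgebra.comul (R := k) (A := C)).rTensor M w)) := fun w => by
      induction w using TensorProduct.induction_on with
      | zero => simp
      | tmul c v =>
        simp only [cofree, LinearMap.comp_apply, LinearMap.rTensor_tmul, LinearEquiv.coe_coe,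
          LinearMap.lTensor_tmul]
        generalize (Coalgebra.comul (R := k) c) = y
        induction y using TensorProduct.induction_on with
        | zero => simp
        | tmul a b => simp
        | add a b ha hb => simp only [TensorProduct.add_tmul, map_add, ha, hb]
      | add a b ha hb => simp only [map_add, ha, hb]
    rw [LinearMap.lTensor_comp]
    simp only [LinearMap.comp_apply, LinearEquiv.coe_coe] at h ⊢
    rw [← h]
    exact e1 _)

/-- The linear map `C ⊗ V → V` given by the counit. -/
def cofreeCounit (V : Type u) [AddCommGroup V] [Module k V] : C ⊗[k] V →ₗ[k] V :=
  (TensorProduct.lid k V).toLinearMap ∘ₗ (Coalgebra.counit (R := k) (A := C)).rTensor V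

theorem lTensor_cofreeCounit (V : Type u) [AddCommGroup V] [Module k V]
    (w : C ⊗[k] V) : (cofreeCounit V).lTensor C ((cofree (C := C) V).coact w) = w := by
  induction w using TensorProduct.induction_on with
  | zero => simp
  | tmul c v =>
    have h := Coalgebra.lTensor_counit_comul (R := k) c
    have e : ∀ y : C ⊗[k] C, (cofreeCounit V).lTensor C (TensorProduct.assoc k C C V (y ⊗ₜ[k] v))
        = (TensorProduct.rid k C ((Coalgebra.counit (R := k) (A := C)).lTensor C y)) ⊗ₜ[k] v :=
        fun y => by
      induction y using TensorProduct.induction_on with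
      | zero => simp
      | tmul a b => simp [cofreeCounit, TensorProduct.smul_tmul]
      | add a b ha hb => simp only [TensorProduct.add_tmul, map_add, ha, hb]
    refine (e _).trans ?_
    rw [h]
    simp
  | add a b ha hb => simp only [map_add, ha, hb]

theorem toCofree_counit (M : LeftComodule k C) {V : Type u} [AddCommGroup V] [Module k V]
    (g : M ⟶ cofree (C := C) V) : toCofree M (cofreeCounit V ∘ₗ lin g) = g := by
  refine hom_ext (LinearMap.ext fun x => ?_)
  have h := LinearMap.congr_fun (comm g) x
  simp only [LinearMap.comp_apply] at h
  change (cofreeCounit V ∘ₗ lin g).lTensor C (M.coact x) = lin g x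
  rw [LinearMap.lTensor_comp, LinearMap.comp_apply, ← h]
  exact lTensor_cofreeCounit V _

instance injective_cofree (V : Type u) [AddCommGroup V] [Module k V] :
    Injective (cofree (k := k) (C := C) V) where
  factors {M N} g f _ := by
    have hf := injective_of_mono f
    obtain ⟨r, hr⟩ := (lin f).exists_leftInverse_of_injective (LinearMap.ker_eq_bot.2 hf)
    refine ⟨toCofree N (cofreeCounit V ∘ₗ lin g ∘ₗ r), ?_⟩
    refine Eq.trans ?_ (toCofree_counit M g)
    refine hom_ext (LinearMap.ext fun x => ?_)
    have h := LinearMap.congr_fun (comm f) x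
    simp only [LinearMap.comp_apply] at h
    change (cofreeCounit V ∘ₗ lin g ∘ₗ r).lTensor C (N.coact (lin f x))
      = (cofreeCounit V ∘ₗ lin g).lTensor C (M.coact x)
    rw [h, ← LinearMap.comp_apply, ← LinearMap.lTensor_comp]
    rw [LinearMap.comp_assoc, LinearMap.comp_assoc, hr, LinearMap.comp_id]

/-- The coaction embeds a comodule into a cofree one. -/
theorem mono_toCofree_id (M : LeftComodule k C) : Mono (toCofree M LinearMap.id) := by
  refine mono_of_injective _ fun x y hxy => ?_
  have h : M.coact x = M.coact y := by
    have : ∀ z, lin (toCofree M LinearMap.id) z = M.coact z := fun z => by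
      change LinearMap.id.lTensor C (M.coact z) = _
      simp
    rw [← this, ← this, hxy]
  have h1 := LinearMap.congr_fun M.counit_coact x
  have h2 := LinearMap.congr_fun M.counit_coact y
  simp only [LinearMap.comp_apply, LinearMap.id_apply] at h1 h2
  rw [← h1, ← h2, h]

/-! ### Full faithfulness of the comodule inclusion functor -/

/-- The functionals on `C` separate the points of `C ⊗ V`. -/
theorem eq_zero_of_forall_ev {V : Type u} [AddCommGroup V] [Module k V] (w : C ⊗[k] V)
    (h : ∀ f : DualAlgebra k C, TensorProduct.lid k V ((ev f).rTensor V w) = 0) : w = 0 := by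
  classical
  let b := Module.Basis.ofVectorSpace k C
  refine (TensorProduct.equivFinsuppOfBasisLeft b).injective (Finsupp.ext fun i => ?_)
  have e : ∀ w : C ⊗[k] V, TensorProduct.equivFinsuppOfBasisLeft b w i
      = TensorProduct.lid k V ((ev (ofDual (b.coord i))).rTensor V w) := fun w => by
    induction w using TensorProduct.induction_on with
    | zero => simp
    | tmul a b => simp
    | add a b ha hb => simp only [map_add, Finsupp.add_apply, ha, hb]
  rw [e, h]
  simp

theorem inclusion_map_apply {M N : LeftComodule k C} (φ : M ⟶ N) (x : M) :
    ((inclusion k C).map φ).hom x = lin φ x := rfl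

instance : (inclusion k C).Faithful where
  map_injective {M N} f g h := hom_ext (LinearMap.ext fun x => by
    rw [← inclusion_map_apply, h, inclusion_map_apply])

/-- A map of `C^*`-modules between comodules is a morphism of comodules. -/
theorem exists_hom_of_linear {M N : LeftComodule k C} (ψ : M →ₗ[DualAlgebra k C] N) :
    ∃ φ : M ⟶ N, ∀ x, lin φ x = ψ x := by
  let φ : M →ₗ[k] N :=
    { toFun := ψ
      map_add' := map_add ψ
      map_smul' := fun r x => by
        rw [← algebraMap_smul M r x, map_smul, algebraMap_smul]; rfl }
  refine ⟨mkHom φ (LinearMap.ext fun x => ?_), fun x => rfl⟩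
  rw [← sub_eq_zero]
  refine eq_zero_of_forall_ev _ fun f => ?_
  rw [map_sub, map_sub, sub_eq_zero]
  have e : ∀ w : C ⊗[k] M, TensorProduct.lid k N ((ev f).rTensor N (φ.lTensor C w))
      = φ (TensorProduct.lid k M ((ev f).rTensor M w)) := fun w => by
    induction w using TensorProduct.induction_on with
    | zero => simp
    | tmul a b => simp
    | add a b ha hb => simp only [map_add, ha, hb]
  rw [LinearMap.comp_apply, LinearMap.comp_apply, e]
  exact (map_smul ψ f x).symm

instance : (inclusion k C).Full where
  map_surjective {M N} g := by
    obtain ⟨φ, hφ⟩ := exists_hom_of_linear g.hom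
    exact ⟨φ, by ext x; exact hφ x⟩

end LeftComodule

end

noncomputable section

/-! ### Local nilpotency of the action of the augmentation ideal -/

namespace Coaugmented

open LeftComodule

variable {k C : Type u} [Field k] [AddCommGroup C] [Module k C] [Coalgebra k C]

theorem ev_prod_eq_zero_of_iteratedComul (γ : k →ₗc[k] C) (n : ℕ) (c : C)
    (hc : iteratedComul γ n (proj γ c) = 0) (l : List (DualAlgebra k C)) (hl : n + 1 ≤ l.length)
    (hf : ∀ f ∈ l, ev f (γ 1) = 0) : ev l.prod c = 0 := by
  induction n generalizing c l with
  | zero =>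
    obtain ⟨f, l, rfl⟩ := List.exists_cons_of_length_pos (show 0 < l.length by omega)
    have hc' : proj γ c = 0 := (degreeOne γ).injective (hc.trans (map_zero _).symm)
    obtain ⟨a, rfl⟩ := (Submodule.Quotient.mk_eq_zero _).1 hc'
    have h : γ.toLinearMap a = a • γ 1 := by
      rw [← map_smul, smul_eq_mul, mul_one]; rfl
    rw [h, map_smul, List.prod_cons, ev_mul, comul_apply_one]
    simp [hf f (by simp)]
  | succ n ih =>
    obtain ⟨f, l, rfl⟩ := List.exists_cons_of_length_pos (show 0 < l.length by omega)
    rw [List.prod_cons, ← ev_ract]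
    refine ih _ ?_ l (by simpa using hl) fun g hg => hf g (by simp [hg])
    -- Since `f` vanishes on `γ(k)`, it descends to a functional `f'` on `D`.
    let f' : Reduced γ →ₗ[k] k := (LinearMap.range γ.toLinearMap).liftQ (ev f) (by
      rintro _ ⟨a, rfl⟩
      have h : γ.toLinearMap a = a • γ 1 := by
        rw [← map_smul, smul_eq_mul, mul_one]; rfl
      rw [LinearMap.mem_ker, h, map_smul, hf f (by simp), smul_zero])
    have hf' : ∀ c, f' (proj γ c) = ev f c := fun c => rfl
    have e : ∀ w : C ⊗[k] C, iteratedComul γ n (proj γ (TensorProduct.rid k C ((ev f).lTensor C w)))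
        = TensorProduct.rid k _ ((f' ∘ₗ (degreeOne γ).symm.toLinearMap).lTensor _
          (TensorProduct.map (iteratedComul γ n) (degreeOne γ).toLinearMap
            (TensorProduct.map (proj γ) (proj γ) w))) := fun w => by
      induction w using TensorProduct.induction_on with
      | zero =>
        simp only [map_zero]
      | tmul a b =>
        have h1 := (degreeOne γ).symm_apply_apply (proj γ b)
        simp only [LinearMap.lTensor_tmul, TensorProduct.rid_tmul, TensorProduct.map_tmul, map_smul,
          LinearMap.comp_apply, LinearEquiv.coe_coe]
        rw [h1, hf']
      | add a b ha hb => simp only [map_add, ha, hb]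
    rw [iteratedComul_succ_apply, LinearEquiv.map_eq_zero_iff] at hc
    refine (e (Coalgebra.comul c)).trans ?_
    have h2 : TensorProduct.map (proj γ) (proj γ) (Coalgebra.comul (R := k) c)
      = reducedComul γ (proj γ c) := rfl
    rw [h2, hc, map_zero, map_zero]

/-- In a conilpotent coalgebra, every element is annihilated by all sufficiently long products of
functionals vanishing on the coaugmentation. -/
theorem exists_ev_prod_eq_zero {γ : k →ₗc[k] C} (hC : IsConilpotent γ) (c : C) :
    ∃ m, ∀ l : List (DualAlgebra k C), m ≤ l.length → (∀ f ∈ l, ev f (γ 1) = 0) →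
      ev l.prod c = 0 := by
  obtain ⟨n, -, hn⟩ := hC (proj γ c)
  exact ⟨n + 1, ev_prod_eq_zero_of_iteratedComul γ n c hn⟩

theorem exists_prod_smul_eq_zero {γ : k →ₗc[k] C} (hC : IsConilpotent γ) (M : LeftComodule k C)
    (x : M) : ∃ m, ∀ l : List (DualAlgebra k C), m ≤ l.length → (∀ f ∈ l, ev f (γ 1) = 0) →
      l.prod • x = 0 := by
  have h : ∀ w : C ⊗[k] M, ∃ m, ∀ l : List (DualAlgebra k C), m ≤ l.length →
      (∀ f ∈ l, ev f (γ 1) = 0) → TensorProduct.lid k M ((ev l.prod).rTensor M w) = 0 := by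
    intro w
    induction w using TensorProduct.induction_on with
    | zero => exact ⟨0, by simp⟩
    | tmul c v =>
      obtain ⟨m, hm⟩ := exists_ev_prod_eq_zero hC c
      exact ⟨m, fun l hl hf => by simp [hm l hl hf]⟩
    | add a b ha hb =>
      obtain ⟨m, hm⟩ := ha
      obtain ⟨m', hm'⟩ := hb
      refine ⟨max m m', fun l hl hf => ?_⟩
      rw [map_add, map_add, hm l (le_of_max_le_left hl) hf, hm' l (le_of_max_le_right hl) hf,
        add_zero]
  exact h (M.coact x)

/-- A proper `C^*`-submodule `B` of a comodule `M` over a conilpotent coalgebra can be enlarged by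
a one-dimensional trivial module: the socle of `M / B` is nonzero. -/
theorem exists_socle {γ : k →ₗc[k] C} (hC : IsConilpotent γ) (M : LeftComodule k C)
    (B : Submodule (DualAlgebra k C) M) (hB : B ≠ ⊤) :
    ∃ y : M, y ∉ B ∧ ∀ f : DualAlgebra k C, ev f (γ 1) = 0 → f • y ∈ B := by
  classical
  obtain ⟨x, hx⟩ : ∃ x, x ∉ B := by
    by_contra! h
    exact hB (eq_top_iff.2 fun x _ => h x)
  -- The element `y` is `l x` for a product `l` of elements of the augmentation ideal of maximal
  -- length such that `l x` is not in `B`.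
  have hex : ∃ m, ∀ l : List (DualAlgebra k C), m ≤ l.length → (∀ f ∈ l, ev f (γ 1) = 0) →
      l.prod • x ∈ B := by
    obtain ⟨m, hm⟩ := exists_prod_smul_eq_zero hC M x
    exact ⟨m, fun l hl hf => by rw [hm l hl hf]; exact B.zero_mem⟩
  obtain ⟨m, hm⟩ : ∃ m, Nat.find hex = m + 1 := by
    refine Nat.exists_eq_succ_of_ne_zero fun h0 => hx ?_
    have := Nat.find_spec hex
    rw [h0] at this
    simpa using this [] (by simp) (by simp)
  have hlt := Nat.find_min hex (m := m) (by omega)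
  push Not at hlt
  obtain ⟨l, hl, hf, hlx⟩ := hlt
  refine ⟨l.prod • x, hlx, fun f hf0 => ?_⟩
  rw [smul_smul, ← List.prod_cons]
  refine Nat.find_spec hex _ (by rw [hm]; simpa using hl) fun g hg => ?_
  rcases List.mem_cons.1 hg with rfl | hg
  · exact hf0
  · exact hf g hg

/-- The identification of the vector space underlying the trivial comodule with `k`. -/
def scalar (γ : k →ₗc[k] C) : trivialComodule γ ≃ₗ[k] k := LinearEquiv.refl k k

theorem scalar_smul (γ : k →ₗc[k] C) (f : DualAlgebra k C)
    (a : trivialComodule γ) : scalar γ (f • a) = ev f (γ 1) * scalar γ a := by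
  have h : ∀ b : k, TensorProduct.lid k k ((ev f).rTensor k (γ b ⊗ₜ[k] (1 : k)))
      = ev f (γ 1) * b := fun b => by
    have h : γ b = b • γ 1 := by rw [← map_smul, smul_eq_mul, mul_one]
    rw [h]
    simp [mul_comm]
  exact h a

end Coaugmented

/-! ### Extending the vanishing of `Ext` from the trivial comodule to all comodules -/

section

variable {R : Type u} [Ring R]

/-- By dimension shifting along injective embeddings of `X`, the vanishing of `Ext^{n+1}(-, X)` is
a lifting property with respect to a single surjection with injective source. -/
theorem exists_lifting_iff_ext_eq_zero (n : ℕ) (X : ModuleCat.{u} R) :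
    ∃ (E N : ModuleCat.{u} R) (p : E ⟶ N), Injective E ∧ ∀ A : ModuleCat.{u} R,
      (∀ x : Ext A X (n + 1), x = 0) ↔ ∀ f : A ⟶ N, ∃ g : A ⟶ E, g ≫ p = f := by
  induction n generalizing X with
  | zero =>
    let S := ShortComplex.mk _ _ (cokernel.condition (Injective.ι X))
    have hS : S.ShortExact := { exact := ShortComplex.exact_cokernel _ }
    refine ⟨S.X₂, S.X₃, S.g, inferInstanceAs (Injective (Injective.under X)), fun A => ?_⟩
    constructor
    · intro h f
      obtain ⟨x, hx⟩ := Ext.covariant_sequence_exact₃ A hS (Ext.mk₀ f) (zero_add 1) (h _)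
      obtain ⟨g, rfl⟩ := (Ext.mk₀_bijective _ _).2 x
      rw [Ext.mk₀_comp_mk₀] at hx
      exact ⟨g, (Ext.mk₀_bijective _ _).1 hx⟩
    · intro h x
      obtain ⟨y, rfl⟩ := Ext.covariant_sequence_exact₁ A hS x
        (Ext.eq_zero_of_injective (I := Injective.under X) _) (zero_add 1)
      obtain ⟨f, rfl⟩ := (Ext.mk₀_bijective _ _).2 y
      obtain ⟨g, rfl⟩ := h f
      rw [← Ext.mk₀_comp_mk₀, Ext.comp_assoc _ _ _ (add_zero 0) (zero_add 1) (by simp),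
        hS.comp_extClass, Ext.comp_zero]
  | succ n ih =>
    let S := ShortComplex.mk _ _ (cokernel.condition (Injective.ι X))
    have hS : S.ShortExact := { exact := ShortComplex.exact_cokernel _ }
    obtain ⟨E, N, p, hE, h⟩ := ih S.X₃
    refine ⟨E, N, p, hE, fun A => Iff.trans ?_ (h A)⟩
    constructor
    · intro hx x
      obtain ⟨y, hy⟩ := Ext.covariant_sequence_exact₃ A hS x rfl (hx _)
      rw [← hy, Ext.eq_zero_of_injective (I := Injective.under X) y, Ext.zero_comp]
    · intro hx x
      obtain ⟨y, rfl⟩ := Ext.covariant_sequence_exact₁ A hS x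
        (Ext.eq_zero_of_injective (I := Injective.under X) _) rfl
      rw [hx y, Ext.zero_comp]

end

namespace Coaugmented

open LeftComodule

variable {k C : Type u} [Field k] [AddCommGroup C] [Module k C] [Coalgebra k C]

theorem ev_sub_algebraMap (γ : k →ₗc[k] C) (f : DualAlgebra k C) :
    ev (f - algebraMap k (DualAlgebra k C) (ev f (γ 1))) (γ 1) = 0 := by
  have h : Coalgebra.counit (R := k) (γ 1) = 1 := by
    rw [CoalgHomClass.counit_comp_apply]
    simp
  have h1 : ev (f - algebraMap k (DualAlgebra k C) (ev f (γ 1))) (γ 1)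
      = ev f (γ 1) - ev (algebraMap k (DualAlgebra k C) (ev f (γ 1))) (γ 1) := rfl
  have h2 := ev_algebraMap_mul (ev f (γ 1)) (1 : DualAlgebra k C) (γ 1)
  rw [one_mul, ev_one, h, mul_one] at h2
  rw [h1, h2, sub_self]

theorem smul_eq_of_annihilated (γ : k →ₗc[k] C) {X : Type u} [AddCommGroup X]
    [Module (DualAlgebra k C) X] (x : X)
    (hx : ∀ f : DualAlgebra k C, ev f (γ 1) = 0 → f • x = 0) (f : DualAlgebra k C) :
    f • x = algebraMap k (DualAlgebra k C) (ev f (γ 1)) • x := by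
  rw [← sub_eq_zero, ← sub_smul]
  exact hx _ (ev_sub_algebraMap γ f)

/-- The map of `C^*`-modules from the trivial module to `X` corresponding to an element of `X`
annihilated by the augmentation ideal. -/
def trivialLift (γ : k →ₗc[k] C) {X : Type u} [AddCommGroup X] [Module (DualAlgebra k C) X] (x : X)
    (hx : ∀ f : DualAlgebra k C, ev f (γ 1) = 0 → f • x = 0) :
    trivialComodule γ →ₗ[DualAlgebra k C] X where
  toFun a := algebraMap k (DualAlgebra k C) (scalar γ a) • x
  map_add' a b := by rw [← add_smul, ← map_add, ← map_add]
  map_smul' f a := by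
    rw [scalar_smul, map_mul, Algebra.commutes, mul_smul, ← smul_eq_of_annihilated γ x hx,
      RingHom.id_apply, smul_smul, smul_smul, Algebra.commutes]

theorem trivialLift_one (γ : k →ₗc[k] C) {X : Type u} [AddCommGroup X]
    [Module (DualAlgebra k C) X] (x : X)
    (hx : ∀ f : DualAlgebra k C, ev f (γ 1) = 0 → f • x = 0) :
    trivialLift γ x hx ((scalar γ).symm 1) = x := by
  change algebraMap k (DualAlgebra k C) (scalar γ ((scalar γ).symm 1)) • x = x
  rw [LinearEquiv.apply_symm_apply, map_one, one_smul]

theorem trivialLift_injective (γ : k →ₗc[k] C) {X : Type u} [AddCommGroup X]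
    [Module (DualAlgebra k C) X] (x : X)
    (hx : ∀ f : DualAlgebra k C, ev f (γ 1) = 0 → f • x = 0) (hx0 : x ≠ 0) :
    Function.Injective (trivialLift γ x hx) := by
  rw [injective_iff_map_eq_zero]
  intro a ha
  by_contra h0
  refine hx0 ?_
  have h : algebraMap k (DualAlgebra k C) (scalar γ a)⁻¹ •
      algebraMap k (DualAlgebra k C) (scalar γ a) • x = 0 := by
    rw [show algebraMap k (DualAlgebra k C) (scalar γ a) • x = 0 from ha, smul_zero]
  rwa [smul_smul, ← map_mul, inv_mul_cancel₀ (by simpa using h0), map_one, one_smul] at h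

/-- If `E` is injective and maps from the trivial module to `N` lift along `p : E → N`, then so do
maps from any comodule over a conilpotent coalgebra: a maximal partial lift is everywhere defined,
as it could otherwise be extended over an element of the socle of the quotient. -/
theorem exists_lift_of_conilpotent {γ : k →ₗc[k] C} (hC : IsConilpotent γ)
    {E N : ModuleCat.{u} (DualAlgebra k C)} [hE : Injective E] (p : E ⟶ N)
    (hp : ∀ f : (inclusion k C).obj (trivialComodule γ) ⟶ N, ∃ g, g ≫ p = f)
    (M : LeftComodule k C) (f : (inclusion k C).obj M ⟶ N) : ∃ g, g ≫ p = f := by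
  have hE' := (Module.injective_iff_injective_object (DualAlgebra k C) E).2 hE
  let S : Set (M →ₗ.[DualAlgebra k C] E) := {g | ∀ x : g.domain, p.hom (g x) = f.hom (x : M)}
  obtain ⟨g, hg⟩ : ∃ g, Maximal (· ∈ S) g := by
    refine zorn_le_nonempty₀ S (fun c hcS hc y hy => ?_) ⊥ ?_ |>.imp fun _ h => h.2
    · refine ⟨LinearPMap.sSup c hc.directedOn, fun x => ?_, fun z hz => LinearPMap.le_sSup _ hz⟩
      obtain ⟨g, hg, hx⟩ := (LinearPMap.mem_domain_sSup_iff ⟨y, hy⟩ hc.directedOn).1 x.2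
      have := LinearPMap.sSup_apply hc.directedOn hg ⟨x, hx⟩
      exact (congrArg p.hom this).trans (hcS hg ⟨x, hx⟩)
    · rintro ⟨x, hx⟩
      obtain rfl := (Submodule.mem_bot _).1 hx
      exact (map_zero p.hom).trans (map_zero f.hom).symm
  obtain ⟨g', hg'⟩ := hE'.out (X := g.domain) (Y := M) g.domain.subtype
    (Submodule.injective_subtype _) g.toFun
  have hdom : g.domain = ⊤ := by
    by_contra hne
    obtain ⟨y, hy, hI⟩ := exists_socle hC M g.domain hne
    -- The defect of the extension `g'` of `g` vanishes on the domain of `g`.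
    let f₀ : M →ₗ[DualAlgebra k C] N := f.hom
    let d : M →ₗ[DualAlgebra k C] N := f₀ - p.hom ∘ₗ g'
    have hd : ∀ x ∈ g.domain, d x = 0 := fun x hx => by
      have h1 : g' x = g ⟨x, hx⟩ := hg' ⟨x, hx⟩
      have h2 : p.hom (g ⟨x, hx⟩) = f₀ x := hg.1 ⟨x, hx⟩
      simp only [d, LinearMap.sub_apply, LinearMap.comp_apply, h1, h2, sub_self]
    have hdy : ∀ f : DualAlgebra k C, ev f (γ 1) = 0 → f • d y = 0 := fun f hf => by
      rw [← map_smul, hd _ (hI f hf)]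
    -- A lift `τ` of the defect at `y`, extended from the line of `y` in `M / dom g` to the whole
    -- quotient, corrects `g'` to a map that extends `g` and lifts `f` at `y` as well.
    obtain ⟨τ, hτ⟩ := hp (ModuleCat.ofHom (trivialLift γ (d y) hdy))
    obtain ⟨τ', hτ'⟩ := hE'.out (X := trivialComodule γ) (Y := M ⧸ g.domain)
      (trivialLift γ (g.domain.mkQ y) fun f hf => by
        rw [← map_smul]; exact (Submodule.Quotient.mk_eq_zero _).2 (hI f hf))
      (trivialLift_injective _ _ _ fun h => hy ((Submodule.Quotient.mk_eq_zero _).1 h)) τ.hom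
    let h : M →ₗ[DualAlgebra k C] E := g' + τ' ∘ₗ g.domain.mkQ
    let h' : M →ₗ.[DualAlgebra k C] E :=
      ⟨LinearMap.eqLocus (p.hom ∘ₗ h) f.hom, h ∘ₗ Submodule.subtype _⟩
    have hle : g ≤ h' := by
      have hh : ∀ x : g.domain, h x = g x := fun x => by
        have h1 : g' x = g x := hg' x
        have h2 : g.domain.mkQ (x : M) = 0 := (Submodule.Quotient.mk_eq_zero _).2 x.2
        simp only [h, LinearMap.add_apply, LinearMap.comp_apply, h1, h2, map_zero, add_zero]
      refine ⟨fun x hx => ?_, fun x z hxz => ?_⟩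
      · change p.hom (h x) = f.hom x
        rw [hh ⟨x, hx⟩, hg.1 ⟨x, hx⟩]
      · rw [← hh x, hxz]; rfl
    have hy' : y ∈ h'.domain := by
      change p.hom (g' y + τ' (g.domain.mkQ y)) = f.hom y
      have h1 : τ' (g.domain.mkQ y) = τ.hom ((scalar γ).symm 1) := by
        refine Eq.trans ?_ (hτ' _)
        rw [trivialLift_one]
      have h2 : p.hom (τ.hom ((scalar γ).symm 1)) = d y :=
        (congrArg (fun q => q.hom ((scalar γ).symm 1)) hτ).trans (trivialLift_one γ _ hdy)
      rw [map_add, h1, h2]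
      exact add_sub_cancel (p.hom (g' y)) (f₀ y)
    exact hy ((hg.2 (y := h') (fun x => x.2) hle).1 hy')
  refine ⟨ModuleCat.ofHom g', ?_⟩
  ext x
  have hx : x ∈ g.domain := by rw [hdom]; trivial
  have h1 : g' x = g ⟨x, hx⟩ := hg' ⟨x, hx⟩
  exact (congrArg p.hom h1).trans (hg.1 ⟨x, hx⟩)

theorem ext_eq_zero_of_trivial {γ : k →ₗc[k] C} (hC : IsConilpotent γ) (n : ℕ)
    (X : ModuleCat.{u} (DualAlgebra k C))
    (hX : ∀ x : Ext ((inclusion k C).obj (trivialComodule γ)) X (n + 1), x = 0)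
    (M : LeftComodule k C) (x : Ext ((inclusion k C).obj M) X (n + 1)) : x = 0 := by
  obtain ⟨E, N, p, hE, h⟩ := exists_lifting_iff_ext_eq_zero n X
  exact (h _).2 (exists_lift_of_conilpotent hC p ((h _).1 hX) M) x

end Coaugmented

end

noncomputable section

/-! ### Dimension shifting -/

section

universe v v' w w' u'

variable {𝒜 : Type u} [Category.{v} 𝒜] [Abelian 𝒜] [HasExt.{w} 𝒜]

attribute [local simp] Ext.mapExactFunctor_comp Ext.mapExactFunctor_mk₀
  Ext.mapExactFunctor_extClass in
/-- Dimension shifting along an embedding of `M` into an injective object `J` whose image under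
the exact functor `F` has no `Ext^{n+1}` from `F L`. -/
theorem mapExt_bijective_succ {ℬ : Type u'} [Category.{v'} ℬ] [Abelian ℬ] [HasExt.{w'} ℬ]
    (F : 𝒜 ⥤ ℬ) [F.Additive] [PreservesFiniteLimits F] [PreservesFiniteColimits F] (L : 𝒜) (n : ℕ)
    (hn : ∀ M, Function.Bijective (F.mapExtAddHom L M n)) {M J : 𝒜} (f : M ⟶ J) [Mono f]
    [Injective J] (hJ : ∀ x : Ext (F.obj L) (F.obj J) (n + 1), x = 0) :
    Function.Bijective (F.mapExtAddHom L M (n + 1)) := by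
  let S := ShortComplex.mk _ _ (cokernel.condition f)
  have hS : S.ShortExact := { exact := ShortComplex.exact_cokernel f }
  exact AddMonoidHom.bijective_of_surjective_of_bijective_of_right_exact _ _ _ _
    (F.mapExtAddHom L S.X₂ n) (F.mapExtAddHom L S.X₃ n) (F.mapExtAddHom L S.X₁ (n + 1))
    (by cat_disch) (by cat_disch)
    ((ShortComplex.ab_exact_iff_function_exact _).mp
      (Ext.covariant_sequence_exact₃' L hS n (n + 1) rfl))
    ((ShortComplex.ab_exact_iff_function_exact _).mp
      (Ext.covariant_sequence_exact₃' (F.obj L) (hS.map F) n (n + 1) rfl))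
    (hn _).surjective (hn _)
    (fun x₁ ↦ Ext.covariant_sequence_exact₁ _ hS x₁
      (Ext.eq_zero_of_injective (I := J) _) rfl)
    (fun y₁ ↦ Ext.covariant_sequence_exact₁ _ (hS.map F) y₁ (hJ _) rfl)

/-- A class `ε ∈ Ext^n(X, K)` exhibits `K` as an `n`-th syzygy of `X` if composition with `ε`
induces the dimension shift `Ext^j(K, Y) → Ext^{n+j}(X, Y)`, surjective for all `j` and injective
for `j ≥ 1`. -/
def IsSyzygyClass {X K : 𝒜} {n : ℕ} (ε : Ext X K n) : Prop :=
  ∀ (Y : 𝒜) (j m : ℕ) (h : n + j = m),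
    (∀ x : Ext X Y m, ∃ β : Ext K Y j, ε.comp β h = x) ∧
      (1 ≤ j → ∀ β : Ext K Y j, ε.comp β h = 0 → β = 0)

theorem isSyzygyClass_id (X : 𝒜) : IsSyzygyClass (Ext.mk₀ (𝟙 X)) := by
  intro Y j m h
  obtain rfl : j = m := by omega
  exact ⟨fun x => ⟨x, Ext.mk₀_id_comp x⟩, fun _ β hβ => by rwa [Ext.mk₀_id_comp] at hβ⟩

variable {X : 𝒜} {S : ShortComplex 𝒜} (hS : S.ShortExact) {n : ℕ}

theorem eq_zero_of_extClass_comp [Projective S.X₂] {Y : 𝒜} {j m : ℕ} (hj : 1 ≤ j) (h : 1 + j = m)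
    (β : Ext S.X₁ Y j) (hβ : hS.extClass.comp β h = 0) : β = 0 := by
  obtain ⟨x, rfl⟩ := Ext.contravariant_sequence_exact₁ hS Y β h hβ
  obtain ⟨j, rfl⟩ := Nat.exists_eq_add_of_le' hj
  rw [Ext.eq_zero_of_projective x, Ext.comp_zero]

theorem IsSyzygyClass.comp_extClass [Projective S.X₂] {ε : Ext X S.X₃ n} (hε : IsSyzygyClass ε) :
    IsSyzygyClass (ε.comp hS.extClass rfl) := by
  intro Y j m h
  refine ⟨fun x => ?_, fun hj β hβ => ?_⟩
  · obtain ⟨y, rfl⟩ := (hε Y (j + 1) m (by omega)).1 x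
    obtain ⟨β, rfl⟩ := Ext.contravariant_sequence_exact₃ hS Y y (Ext.eq_zero_of_projective _)
      (add_comm 1 j)
    exact ⟨β, Ext.comp_assoc _ _ _ _ _ (by omega)⟩
  · rw [Ext.comp_assoc _ _ _ rfl (rfl : 1 + j = 1 + j) (by omega)] at hβ
    exact eq_zero_of_extClass_comp hS hj rfl β ((hε _ _ _ (by omega)).2 (by omega) _ hβ)

theorem IsSyzygyClass.exists_extension {ε : Ext X S.X₃ n} (hε : IsSyzygyClass ε) {Y : 𝒜}
    (φ : S.X₁ ⟶ Y) (hφ : (ε.comp hS.extClass rfl).comp (Ext.mk₀ φ) (add_zero _) = 0) :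
    ∃ ψ : S.X₂ ⟶ Y, S.f ≫ ψ = φ := by
  rw [Ext.comp_assoc _ _ _ rfl (add_zero 1) (by omega)] at hφ
  obtain ⟨x, hx⟩ := Ext.contravariant_sequence_exact₁ hS Y (Ext.mk₀ φ) (add_zero 1)
    ((hε _ _ _ _).2 le_rfl _ hφ)
  obtain ⟨ψ, rfl⟩ := (Ext.mk₀_bijective _ _).2 x
  rw [Ext.mk₀_comp_mk₀] at hx
  exact ⟨ψ, (Ext.mk₀_bijective _ _).1 hx⟩

theorem comp_extClass_comp_mk₀_eq_zero (ε : Ext X S.X₃ n) {Y : 𝒜} (ψ : S.X₂ ⟶ Y) :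
    (ε.comp hS.extClass rfl).comp (Ext.mk₀ (S.f ≫ ψ)) (add_zero _) = 0 := by
  rw [Ext.comp_assoc _ _ _ rfl (add_zero 1) (by omega), ← Ext.mk₀_comp_mk₀,
    hS.extClass_comp_assoc, Ext.comp_zero]

end

/-! ### Duality between tuples of functionals and tuples of elements of the coalgebra -/

namespace LeftComodule

variable {k C : Type u} [Field k] [AddCommGroup C] [Module k C] [Coalgebra k C]

/-- The pairing of `(C^*)^r` with `C^r`. -/
def pair {r : ℕ} (g : Fin r → DualAlgebra k C) : (Fin r → C) →ₗ[k] k :=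
  ∑ i, ev (g i) ∘ₗ LinearMap.proj i

theorem pair_apply {r : ℕ} (g : Fin r → DualAlgebra k C) (z : Fin r → C) :
    pair g z = ∑ i, ev (g i) (z i) := by
  simp [pair]

theorem exists_pair_eq {r : ℕ} (φ : (Fin r → C) →ₗ[k] k) :
    ∃ g : Fin r → DualAlgebra k C, pair g = φ := by
  refine ⟨fun i => ofDual (φ ∘ₗ LinearMap.single k (fun _ => C) i), LinearMap.ext fun z => ?_⟩
  rw [pair_apply]
  simp only [ev_ofDual, LinearMap.comp_apply, LinearMap.single_apply]
  rw [← map_sum, Finset.univ_sum_single]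

theorem pair_injective {r : ℕ} :
    Function.Injective (pair : (Fin r → DualAlgebra k C) → (Fin r → C) →ₗ[k] k) := by
  intro g h hgh
  refine funext fun i => ev_injective (LinearMap.ext fun c => ?_)
  have := LinearMap.congr_fun hgh (Pi.single i c)
  rw [pair_apply, pair_apply, Finset.sum_eq_single i, Finset.sum_eq_single i] at this
  · simpa using this
  all_goals simp +contextual

theorem pair_add {r : ℕ} (g h : Fin r → DualAlgebra k C) : pair (g + h) = pair g + pair h := by
  refine LinearMap.ext fun z => ?_
  simp [pair_apply, Finset.sum_add_distrib]

theorem pair_algebraMap_smul {r : ℕ} (a : k) (g : Fin r → DualAlgebra k C) (z : Fin r → C) :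
    pair (algebraMap k (DualAlgebra k C) a • g) z = a * pair g z := by
  simp only [pair_apply, Pi.smul_apply, smul_eq_mul, Finset.mul_sum]
  exact Finset.sum_congr rfl fun i _ => by rw [Algebra.commutes, ev_algebraMap_mul]

theorem pair_ract {r : ℕ} (f : DualAlgebra k C) (g : Fin r → DualAlgebra k C) (z : Fin r → C) :
    pair g (fun i => ract f (z i)) = pair (f • g) z := by
  simp [pair_apply, ev_ract]

/-- The linear map `C^r → C^s` whose transpose is the map of free `C^*`-modules
`(C^*)^s → (C^*)^r` given by the `s × r` matrix `u`. -/
def transpose {r s : ℕ} (u : Fin s → Fin r → DualAlgebra k C) : (Fin r → C) →ₗ[k] (Fin s → C) :=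
  LinearMap.pi fun j => ∑ i, (regular k C).act (u j i) ∘ₗ LinearMap.proj i

theorem transpose_apply {r s : ℕ} (u : Fin s → Fin r → DualAlgebra k C) (z : Fin r → C)
    (j : Fin s) : transpose u z j = ∑ i, (regular k C).act (u j i) (z i) := by
  simp [transpose]

theorem pair_transpose {r s : ℕ} (u : Fin s → Fin r → DualAlgebra k C)
    (f : Fin s → DualAlgebra k C) (z : Fin r → C) :
    pair f (transpose u z) = pair (Fintype.linearCombination (DualAlgebra k C) u f) z := by
  have h : ∀ i, ev (Fintype.linearCombination (DualAlgebra k C) u f i) (z i)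
      = ∑ j, ev (f j * u j i) (z i) := fun i => by
    rw [Fintype.linearCombination_apply, Finset.sum_apply]
    let e : DualAlgebra k C →+ k :=
      { toFun := fun f => ev f (z i), map_zero' := rfl, map_add' := fun _ _ => rfl }
    exact map_sum e _ _
  rw [pair_apply, pair_apply, Finset.sum_congr rfl fun i _ => h i, Finset.sum_comm]
  refine Finset.sum_congr rfl fun j _ => ?_
  rw [transpose_apply, map_sum]
  exact Finset.sum_congr rfl fun i _ => ev_act_regular _ _ _

/-- Finitely generated submodules of `(C^*)^r` are closed: they are determined by their
annihilators in `C^r`. -/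
theorem mem_range_linearCombination {r s : ℕ} (u : Fin s → Fin r → DualAlgebra k C)
    (g : Fin r → DualAlgebra k C) (hg : ∀ z, transpose u z = 0 → pair g z = 0) :
    ∃ f, Fintype.linearCombination (DualAlgebra k C) u f = g := by
  have h : pair g ∈ LinearMap.range (transpose u).dualMap := by
    rw [LinearMap.range_dualMap_eq_dualAnnihilator_ker, Submodule.mem_dualAnnihilator]
    exact fun z hz => hg z hz
  obtain ⟨φ, hφ⟩ := h
  obtain ⟨f, rfl⟩ := exists_pair_eq φ
  refine ⟨f, pair_injective (LinearMap.ext fun z => ?_)⟩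
  rw [← pair_transpose, ← hφ]
  rfl

theorem mem_range_transpose {r s : ℕ} (u : Fin s → Fin r → DualAlgebra k C) (z : Fin s → C)
    (hz : ∀ f, Fintype.linearCombination (DualAlgebra k C) u f = 0 → pair f z = 0) :
    ∃ w, transpose u w = z := by
  by_contra hne
  obtain ⟨φ, hφ, hle⟩ := Submodule.exists_le_ker_of_notMem
    (p := LinearMap.range (transpose u)) (v := z) hne
  obtain ⟨f, rfl⟩ := exists_pair_eq φ
  refine hφ (hz f (pair_injective (LinearMap.ext fun w => ?_)))
  rw [← pair_transpose]
  refine (hle (LinearMap.mem_range_self _ w)).trans ?_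
  simp [pair_apply]

/-- A map to a cofree comodule from a finitely generated submodule of `(C^*)^r`, given by the
images `x` of the generators `u`, extends to `(C^*)^r`. -/
theorem exists_extension_cofree {r s : ℕ} (V : Type u) [AddCommGroup V] [Module k V]
    (u : Fin s → Fin r → DualAlgebra k C) (x : Fin s → C ⊗[k] V)
    (hx : ∀ f, Fintype.linearCombination (DualAlgebra k C) u f = 0 →
      ∑ j, (cofree (C := C) V).act (f j) (x j) = 0) :
    ∃ w : Fin r → C ⊗[k] V, ∀ j, ∑ i, (cofree (C := C) V).act (u j i) (w i) = x j := by
  classical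
  -- In coordinates with respect to a basis of `V`, the module `C ⊗ V` is a direct sum of copies
  -- of `C`, and the problem is solved in each copy.
  let b := Module.Basis.ofVectorSpace k V
  let e : C ⊗[k] V ≃ₗ[k] _ →₀ C := TensorProduct.equivFinsuppOfBasisRight b
  have he : ∀ (f : DualAlgebra k C) (w : C ⊗[k] V) l,
      e ((cofree (C := C) V).act f w) l = (regular k C).act f (e w l) := fun f w l => by
    induction w using TensorProduct.induction_on with
    | zero => simp only [map_zero, Finsupp.zero_apply]
    | tmul c v =>
      rw [act_cofree_tmul]
      simp [e]
    | add a b ha hb => simp only [map_add, Finsupp.add_apply, ha, hb]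
  have h1 : ∀ z : Fin s → C, (∃ w, transpose u w = z) →
      ∃ w, transpose u w = z ∧ (z = 0 → w = 0) := by
    rintro z ⟨w, hw⟩
    by_cases hz : z = 0
    · exact ⟨0, by rw [hz, map_zero], fun _ => rfl⟩
    · exact ⟨w, hw, fun h => (hz h).elim⟩
  choose W hW hW0 using fun l => h1 (fun j => e (x j) l) (mem_range_transpose u _ fun f hf => by
    have h := congrArg (fun w => ev (1 : DualAlgebra k C) (e w l)) (hx f hf)
    simp only [map_sum, Finsupp.finsetSum_apply, he, map_zero,
      Finsupp.zero_apply] at h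
    rw [pair_apply]
    refine Eq.trans (Finset.sum_congr rfl fun j _ => ?_) h
    exact ((ev_act_regular (f j) 1 _).trans (by rw [one_mul])).symm)
  have hfin : ∀ i l, W l i ≠ 0 → l ∈ Finset.univ.biUnion fun j => (e (x j)).support := by
    intro i l hne
    by_contra hl
    simp only [Finset.mem_biUnion, Finset.mem_univ, true_and, Finsupp.mem_support_iff,
      not_exists, not_not] at hl
    exact hne (congrFun (hW0 l (funext hl)) i)
  refine ⟨fun i => e.symm (Finsupp.onFinset _ (fun l => W l i) (hfin i)), fun j =>
    e.injective (Finsupp.ext fun l => ?_)⟩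
  simp only [map_sum, Finsupp.finsetSum_apply, he, LinearEquiv.apply_symm_apply,
    Finsupp.onFinset_apply]
  rw [← transpose_apply, hW]

end LeftComodule

end

noncomputable section

/-! ### Finite generation of syzygies -/

/-- Finitely many points separate the elements of a finite-dimensional space of functions. -/
theorem exists_separating_tuple {k X : Type*} [Field k] (F : Submodule k (X → k))
    [FiniteDimensional k F] :
    ∃ (s : ℕ) (u : Fin s → X), ∀ φ ∈ F, (∀ j, φ (u j) = 0) → φ = 0 := by
  let e : X → Module.Dual k F := fun x => LinearMap.proj x ∘ₗ F.subtype
  obtain ⟨t, hts, ht⟩ := (Submodule.fg_span_iff_fg_span_finset_subset (R := k) (Set.range e)).1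
    (IsNoetherian.noetherian _)
  choose g hg using fun y : t => hts y.2
  refine ⟨t.card, fun j => g (t.equivFin.symm j), fun φ hφ h => funext fun x => ?_⟩
  have hle : Submodule.span k (Set.range e) ≤ LinearMap.ker (LinearMap.applyₗ (⟨φ, hφ⟩ : F)) := by
    rw [ht, Submodule.span_le]
    intro y hy
    have h1 := h (t.equivFin ⟨y, hy⟩)
    simp only [Equiv.symm_apply_apply] at h1
    have h2 : e (g ⟨y, hy⟩) = y := hg ⟨y, hy⟩
    change y ⟨φ, hφ⟩ = 0
    rw [← h2]
    exact h1
  exact hle (Submodule.subset_span ⟨x, rfl⟩)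

namespace Coaugmented

open LeftComodule

variable {k C : Type u} [Field k] [AddCommGroup C] [Module k C] [Coalgebra k C]

/-- The tuples `z ∈ C^r` defining, by the pairing of `(C^*)^r` with `C^r`, a functional on the
submodule `K` of `(C^*)^r` that is annihilated by the augmentation ideal of `C^*`. -/
def socleTuples (γ : k →ₗc[k] C) {r : ℕ}
    (K : Submodule (DualAlgebra k C) (Fin r → DualAlgebra k C)) :
    Submodule k (Fin r → C) where
  carrier := {z | ∀ f : DualAlgebra k C, ev f (γ 1) = 0 → ∀ g ∈ K, pair (f • g) z = 0}
  zero_mem' f hf g hg := map_zero _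
  add_mem' hz hw f hf g hg := by rw [map_add, hz f hf g hg, hw f hf g hg, add_zero]
  smul_mem' a z hz f hf g hg := by rw [map_smul, hz f hf g hg, smul_zero]

/-- The restriction of the functionals given by tuples `z ∈ C^r` to a submodule of `(C^*)^r`. -/
def pairOn {r : ℕ} (K : Submodule (DualAlgebra k C) (Fin r → DualAlgebra k C)) :
    (Fin r → C) →ₗ[k] (K → k) :=
  LinearMap.pi fun g => pair g.1

theorem pairOn_apply {r : ℕ} (K : Submodule (DualAlgebra k C) (Fin r → DualAlgebra k C))
    (z : Fin r → C) (g : K) : pairOn K z g = pair g.1 z := rfl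

theorem pair_smul_of_mem_socleTuples (γ : k →ₗc[k] C) {r : ℕ}
    {K : Submodule (DualAlgebra k C) (Fin r → DualAlgebra k C)} {z : Fin r → C}
    (hz : z ∈ socleTuples γ K) (f : DualAlgebra k C) {g : Fin r → DualAlgebra k C} (hg : g ∈ K) :
    pair (f • g) z = ev f (γ 1) * pair g z := by
  have h := hz _ (ev_sub_algebraMap γ f) g hg
  have h1 : f • g = (f - algebraMap k (DualAlgebra k C) (ev f (γ 1))) • g
      + algebraMap k (DualAlgebra k C) (ev f (γ 1)) • g := by
    refine funext fun i => ?_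
    simp only [Pi.add_apply, Pi.smul_apply, smul_eq_mul, sub_mul, sub_add_cancel]
  rw [h1, pair_add, LinearMap.add_apply, h, zero_add, pair_algebraMap_smul]

theorem exists_pair_prod_smul_eq_zero {γ : k →ₗc[k] C} (hC : IsConilpotent γ) {r : ℕ}
    (z : Fin r → C) : ∃ m, ∀ l : List (DualAlgebra k C), m ≤ l.length →
      (∀ f ∈ l, ev f (γ 1) = 0) → ∀ g : Fin r → DualAlgebra k C, pair (l.prod • g) z = 0 := by
  choose m hm using fun i => exists_ev_prod_eq_zero hC (z i)
  refine ⟨Finset.univ.sup m, fun l hl hf g => ?_⟩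
  rw [pair_apply]
  refine Finset.sum_eq_zero fun i _ => ?_
  have hi : m i ≤ l.length := (Finset.le_sup (Finset.mem_univ i)).trans hl
  rw [Pi.smul_apply, smul_eq_mul]
  -- Modulo scalars, `g i` is one more factor from the augmentation ideal.
  set a := algebraMap k (DualAlgebra k C) (ev (g i) (γ 1)) with ha
  have h1 : l.prod * g i = (l ++ [g i - a]).prod + l.prod * a := by
    rw [List.prod_append, List.prod_singleton, mul_sub, sub_add_cancel]
  rw [h1, ev_add, LinearMap.add_apply, ha, ev_algebraMap_mul, hm i l hi hf, mul_zero, add_zero]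
  refine hm i _ (by simp; omega) fun f hfl => ?_
  rcases List.mem_append.1 hfl with h | h
  · exact hf f h
  · obtain rfl := List.mem_singleton.1 h
    exact ev_sub_algebraMap γ _

/-- A topological Nakayama lemma: elements `u_j` of a submodule `K` of `(C^*)^r` generate `K` as
soon as they separate the functionals on `K`, given by elements of `C^r`, that are annihilated by
the augmentation ideal. Indeed, the submodule generated by the `u_j` is closed, and if it were
proper, then conilpotency would provide such a functional vanishing on it. -/
theorem linearCombination_surjective_of_separating {γ : k →ₗc[k] C} (hC : IsConilpotent γ) {r s : ℕ}
    {K : Submodule (DualAlgebra k C) (Fin r → DualAlgebra k C)} (u : Fin s → K)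
    (hu : ∀ φ ∈ (socleTuples γ K).map (pairOn K), (∀ j, φ (u j) = 0) → φ = 0) :
    Function.Surjective (Fintype.linearCombination (DualAlgebra k C) u) := by
  classical
  intro g
  by_contra hg
  let v : Fin s → Fin r → DualAlgebra k C := fun j => (u j).1
  have hv : ∀ f, (Fintype.linearCombination (DualAlgebra k C) u f).1
      = Fintype.linearCombination (DualAlgebra k C) v f := fun f => by
    simp [Fintype.linearCombination_apply, v]
  obtain ⟨z, hz, hgz⟩ : ∃ z, transpose v z = 0 ∧ pair g.1 z ≠ 0 := by
    by_contra! h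
    obtain ⟨f, hf⟩ := mem_range_linearCombination v g.1 h
    exact hg ⟨f, Subtype.ext ((hv f).trans hf)⟩
  -- A maximal product `l` of elements of the augmentation ideal with `⟨l K, z⟩ ≠ 0` turns `z` into
  -- the tuple `z l`, whose functional on `K` is nonzero and annihilated by the augmentation ideal.
  have hex : ∃ m, ∀ l : List (DualAlgebra k C), m ≤ l.length → (∀ f ∈ l, ev f (γ 1) = 0) →
      ∀ g ∈ K, pair (l.prod • g) z = 0 := by
    obtain ⟨m, hm⟩ := exists_pair_prod_smul_eq_zero hC z
    exact ⟨m, fun l hl hf g _ => hm l hl hf g⟩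
  obtain ⟨m, hm⟩ : ∃ m, Nat.find hex = m + 1 := by
    refine Nat.exists_eq_succ_of_ne_zero fun h0 => hgz ?_
    have := Nat.find_spec hex
    rw [h0] at this
    simpa using this [] (by simp) (by simp) g.1 g.2
  have hlt := Nat.find_min hex (m := m) (by omega)
  push Not at hlt
  obtain ⟨l, hl, hf, g', hg', hne⟩ := hlt
  refine hne ?_
  rw [← pair_ract]
  refine congrFun (hu _ (Submodule.mem_map_of_mem (r := fun i => ract l.prod (z i)) ?_) fun j => ?_)
    (⟨g', hg'⟩ : K)
  · intro f hf0 g₀ hg₀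
    rw [pair_ract, smul_smul]
    have h1 : l.prod * f = (l ++ [f]).prod := by rw [List.prod_append, List.prod_singleton]
    rw [h1]
    refine Nat.find_spec hex _ (by rw [hm]; simpa using hl) (fun f' hf' => ?_) g₀ hg₀
    rcases List.mem_append.1 hf' with h | h
    · exact hf f' h
    · obtain rfl := List.mem_singleton.1 h
      exact hf0
  · rw [pairOn_apply, pair_ract]
    have h1 : l.prod • v j
        = Fintype.linearCombination (DualAlgebra k C) v (Pi.single j l.prod) := by
      rw [Fintype.linearCombination_apply_single]
    change pair (l.prod • v j) z = 0
    rw [h1, ← pair_transpose, hz, map_zero]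

theorem exists_generators {γ : k →ₗc[k] C} (hC : IsConilpotent γ) {r : ℕ}
    (K : Submodule (DualAlgebra k C) (Fin r → DualAlgebra k C))
    (hK : FiniteDimensional k ((socleTuples γ K).map (pairOn K))) :
    ∃ (s : ℕ) (u : Fin s → K),
      Function.Surjective (Fintype.linearCombination (DualAlgebra k C) u) := by
  obtain ⟨s, u, hu⟩ := exists_separating_tuple ((socleTuples γ K).map (pairOn K))
  exact ⟨s, u, linearCombination_surjective_of_separating hC u hu⟩

/-! ### Functionals on syzygies and extensions of comodules -/

/-- The coaugmentation as a morphism of comodules from the trivial comodule to `C`. -/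
def coaugmentationHom (γ : k →ₗc[k] C) : trivialComodule γ ⟶ regular k C :=
  mkHom (N := regular k C) (γ.toLinearMap ∘ₗ (scalar γ).toLinearMap) (by
    have h : Coalgebra.comul (R := k) ∘ₗ γ.toLinearMap
        = γ.toLinearMap.lTensor C ∘ₗ (TensorProduct.mk k C k).flip 1 ∘ₗ γ.toLinearMap := by
      refine LinearMap.ext_ring ?_
      simp [comul_apply_one]
    exact h)

theorem lin_coaugmentationHom (γ : k →ₗc[k] C) (a : trivialComodule γ) :
    lin (coaugmentationHom γ) a = scalar γ a • γ 1 := by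
  rw [← map_smul, smul_eq_mul, mul_one]
  rfl

instance (γ : k →ₗc[k] C) : Mono (coaugmentationHom γ) := by
  refine mono_of_injective _ fun a b hab => (scalar γ).injective ?_
  have h := congrArg (Coalgebra.counit (R := k)) hab
  rw [lin_coaugmentationHom, lin_coaugmentationHom, map_smul, map_smul,
    CoalgHomClass.counit_comp_apply] at h
  simpa using h

/-- The map of `C^*`-modules from a free module to a comodule given by the images of the basis. -/
def freeLift (M : LeftComodule k C) {r : ℕ} (z : Fin r → M) :
    ModuleCat.of (DualAlgebra k C) (Fin r → DualAlgebra k C) ⟶ (inclusion k C).obj M :=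
  ModuleCat.ofHom (Fintype.linearCombination (DualAlgebra k C) z)

theorem freeLift_apply (M : LeftComodule k C) {r : ℕ} (z : Fin r → M)
    (g : Fin r → DualAlgebra k C) : (freeLift M z).hom g = ∑ i, M.act (g i) (z i) := rfl

/-- The map of `C^*`-modules from `K` to the trivial module given by a tuple in `C^r` whose
pairing with `K` is annihilated by the augmentation ideal. -/
def socleHom (γ : k →ₗc[k] C) {r : ℕ}
    {K : Submodule (DualAlgebra k C) (Fin r → DualAlgebra k C)} {z : Fin r → C}
    (hz : z ∈ socleTuples γ K) :
    ModuleCat.of (DualAlgebra k C) K ⟶ (inclusion k C).obj (trivialComodule γ) :=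
  ModuleCat.ofHom (Y := trivialComodule γ)
    { toFun := fun g => (scalar γ).symm (pair g.1 z)
      map_add' := fun g h => by
        rw [Submodule.coe_add, pair_add, LinearMap.add_apply, map_add]
      map_smul' := fun f g => (scalar γ).injective (by
        rw [RingHom.id_apply, scalar_smul, LinearEquiv.apply_symm_apply,
          LinearEquiv.apply_symm_apply, Submodule.coe_smul,
          pair_smul_of_mem_socleTuples γ hz f g.2]) }

/-- After embedding the trivial comodule into `C`, the functional given by a tuple `z` extends to
the free module as `g ↦ ∑ gᵢ zᵢ`. -/
theorem socleHom_comp (γ : k →ₗc[k] C) {r : ℕ}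
    {K : Submodule (DualAlgebra k C) (Fin r → DualAlgebra k C)} {z : Fin r → C}
    (hz : z ∈ socleTuples γ K) :
    socleHom γ hz ≫ (inclusion k C).map (coaugmentationHom γ)
      = ModuleCat.ofHom K.subtype ≫ freeLift (regular k C) z := by
  ext g
  have h : pair g.1 z • γ 1 = ∑ i, (regular k C).act (g.1 i) (z i) := by
    rw [← sub_eq_zero]
    refine (Module.forall_dual_apply_eq_zero_iff k _).1 fun φ => ?_
    have h1 : φ (∑ i, (regular k C).act (g.1 i) (z i)) = pair (ofDual φ • g.1) z := by
      rw [map_sum, pair_apply]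
      exact Finset.sum_congr rfl fun i _ => ev_act_regular (g.1 i) (ofDual φ) (z i)
    rw [map_sub, h1, pair_smul_of_mem_socleTuples γ hz _ g.2, map_smul, smul_eq_mul, mul_comm,
      ev_ofDual, sub_self]
  refine Eq.trans ?_ h
  refine (lin_coaugmentationHom γ _).trans ?_
  change scalar γ ((scalar γ).symm (pair g.1 z)) • γ 1 = _
  rw [LinearEquiv.apply_symm_apply]

/-- The function on `X` underlying a map of `C^*`-modules from `X` to the trivial module. -/
def homToFun (γ : k →ₗc[k] C) (X : ModuleCat.{u} (DualAlgebra k C)) :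
    (X ⟶ (inclusion k C).obj (trivialComodule γ)) →ₗ[k] (X → k) where
  toFun φ x := scalar γ (φ.hom x)
  map_add' φ ψ := funext fun x => map_add (scalar γ) (φ.hom x) (ψ.hom x)
  map_smul' a φ := funext fun x => by
    have h := algebraMap_smul (trivialComodule γ) a (φ.hom x)
    exact (congrArg (scalar γ) h).trans (map_smul (scalar γ) a _)

theorem finiteDimensional_hom_free (γ : k →ₗc[k] C) (r : ℕ) :
    FiniteDimensional k (ModuleCat.of (DualAlgebra k C) (Fin r → DualAlgebra k C) ⟶
      (inclusion k C).obj (trivialComodule γ)) := by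
  let e : (ModuleCat.of (DualAlgebra k C) (Fin r → DualAlgebra k C) ⟶
      (inclusion k C).obj (trivialComodule γ)) →ₗ[k] (Fin r → k) :=
    LinearMap.funLeft k k (fun i => (Pi.single i 1 : Fin r → DualAlgebra k C)) ∘ₗ homToFun γ _
  refine FiniteDimensional.of_injective e fun φ ψ h => ?_
  refine ModuleCat.hom_ext (LinearMap.pi_ext' fun i => LinearMap.ext_ring ?_)
  exact (scalar γ).injective (congrFun h i)


/-! ### The inductive step -/

/-- The trivial `C^*`-module has a finitely generated `n`-th syzygy. -/
def HasFiniteSyzygy (γ : k →ₗc[k] C) (n : ℕ) : Prop :=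
  ∃ (K : ModuleCat.{u} (DualAlgebra k C))
    (ε : Ext ((inclusion k C).obj (trivialComodule γ)) K n) (r : ℕ)
    (p : ModuleCat.of (DualAlgebra k C) (Fin r → DualAlgebra k C) ⟶ K),
    IsSyzygyClass ε ∧ Function.Surjective p.hom

theorem hasFiniteSyzygy_zero (γ : k →ₗc[k] C) : HasFiniteSyzygy γ 0 := by
  refine ⟨_, Ext.mk₀ (𝟙 _), 1, freeLift (trivialComodule γ) fun _ => (scalar γ).symm 1,
    isSyzygyClass_id _, fun a => ⟨fun _ => algebraMap k _ (scalar γ a), ?_⟩⟩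
  rw [freeLift_apply, Fin.sum_univ_one, ← smul_def, LeftComodule.algebraMap_smul, ← map_smul,
    smul_eq_mul, mul_one]
  exact (scalar γ).symm_apply_apply a

/-- The short exact sequence given by a surjective map of modules and its kernel. -/
abbrev kerSequence {R : Type u} [Ring R] {X Y : ModuleCat.{u} R} (p : X ⟶ Y) :
    ShortComplex (ModuleCat.{u} R) :=
  ShortComplex.mk (ModuleCat.ofHom (LinearMap.ker p.hom).subtype) p
    (ModuleCat.hom_ext (LinearMap.comp_ker_subtype p.hom))

theorem kerSequence_shortExact {R : Type u} [Ring R] {X Y : ModuleCat.{u} R} (p : X ⟶ Y)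
    (hp : Function.Surjective p.hom) : (kerSequence p).ShortExact where
  exact := by
    rw [ShortComplex.ShortExact.moduleCat_exact_iff_function_exact]
    intro x
    change p.hom x = 0 ↔ x ∈ Set.range (LinearMap.ker p.hom).subtype
    simp
  mono_f := (ModuleCat.mono_iff_injective _).2 (Submodule.injective_subtype _)
  epi_g := (ModuleCat.epi_iff_surjective _).2 hp

/-- The functionals on an `(n+1)`-st syzygy that are annihilated by the augmentation ideal and come
from tuples in `C^r` represent classes in `Ext^{n+1}_{C^*}(k, k)` which vanish in
`Ext^{n+1}_{C^*}(k, C)`. Hence, if `Ext^n_C(k, -) = Ext^n_{C^*}(k, -)`, they come from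
`Ext^{n+1}_C(k, k)`. As the functionals representing zero extend to the free module, the space of
all these functionals is finite-dimensional. -/
theorem finiteDimensional_socle (γ : k →ₗc[k] C) {n r : ℕ}
    (hn : ∀ M, Function.Surjective ((inclusion k C).mapExtAddHom (trivialComodule γ) M n))
    (hfin : FiniteDimensional k (Ext (trivialComodule γ) (trivialComodule γ) (n + 1)))
    {K : ModuleCat.{u} (DualAlgebra k C)}
    (p : ModuleCat.of (DualAlgebra k C) (Fin r → DualAlgebra k C) ⟶ K)
    (hp : Function.Surjective p.hom)
    {ε : Ext ((inclusion k C).obj (trivialComodule γ)) K n} (hε : IsSyzygyClass ε) :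
    FiniteDimensional k ((socleTuples γ (LinearMap.ker p.hom)).map
      (pairOn (LinearMap.ker p.hom))) := by
  have hS := kerSequence_shortExact p hp
  let k₀ := (inclusion k C).obj (trivialComodule γ)
  let ε' : Ext k₀ (kerSequence p).X₁ (n + 1) := ε.comp hS.extClass rfl
  let Θ : ((kerSequence p).X₁ ⟶ k₀) →ₗ[k] Ext k₀ k₀ (n + 1) :=
    { toFun := fun φ => ε'.comp (Ext.mk₀ φ) (add_zero _)
      map_add' := fun φ ψ => by rw [Ext.mk₀_add, Ext.comp_add]
      map_smul' := fun a φ => by rw [Ext.mk₀_smul, Ext.comp_smul, RingHom.id_apply] }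
  let E : Submodule k (Ext k₀ k₀ (n + 1)) := LinearMap.range ((inclusion k C).mapExtLinearMap k
    (trivialComodule γ) (trivialComodule γ) (n + 1))
  have hH : (E.comap Θ).FG := by
    refine Submodule.fg_of_fg_map_of_fg_inf_ker Θ ?_ ?_
    · have : FiniteDimensional k E := inferInstanceAs (FiniteDimensional k (LinearMap.range _))
      have := Submodule.finiteDimensional_of_le (Submodule.map_comap_le Θ E)
      exact Module.Finite.iff_fg.1 this
    · have := finiteDimensional_hom_free γ r
      have hle : E.comap Θ ⊓ LinearMap.ker Θ
          ≤ LinearMap.range (Linear.leftComp k k₀ (kerSequence p).f) := by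
        rintro φ ⟨-, hφ⟩
        obtain ⟨ψ, rfl⟩ := hε.exists_extension hS φ hφ
        exact ⟨ψ, rfl⟩
      exact Module.Finite.iff_fg.1 (Submodule.finiteDimensional_of_le hle)
  have hH' : FiniteDimensional k (E.comap Θ) := Module.Finite.iff_fg.2 hH
  refine Submodule.finiteDimensional_of_le
    (S₂ := (E.comap Θ).map (homToFun γ (kerSequence p).X₁)) ?_
  rintro _ ⟨z, hz, rfl⟩
  refine ⟨socleHom γ hz, ?_, funext fun g => (scalar γ).apply_symm_apply _⟩
  -- The short exact sequence `0 → k → C → D → 0` of comodules.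
  let T := ShortComplex.mk _ _ (cokernel.condition (coaugmentationHom γ))
  have hT : T.ShortExact := { exact := ShortComplex.exact_cokernel _ }
  have h0 : (Θ (socleHom γ hz)).comp (Ext.mk₀ (T.map (inclusion k C)).f) (add_zero _) = 0 := by
    change (ε'.comp (Ext.mk₀ (socleHom γ hz)) (add_zero _)).comp
      (Ext.mk₀ ((inclusion k C).map (coaugmentationHom γ))) (add_zero _) = 0
    rw [Ext.comp_assoc _ _ _ (add_zero _) (add_zero _) (by omega), Ext.mk₀_comp_mk₀, socleHom_comp]
    exact comp_extClass_comp_mk₀_eq_zero hS ε (freeLift (regular k C) z)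
  obtain ⟨η, hη⟩ := Ext.covariant_sequence_exact₁ k₀ (hT.map_of_exact (inclusion k C)) _ h0 rfl
  obtain ⟨η', rfl⟩ := hn T.X₃ η
  refine ⟨η'.comp hT.extClass rfl, ?_⟩
  rw [← hη, Functor.mapExtLinearMap_apply, Ext.mapExactFunctor_comp, Ext.mapExactFunctor_extClass]
  rfl

/-- If a syzygy is a finitely generated submodule of a free module, then all its maps to a cofree
comodule extend to the free module, and the corresponding `Ext` vanishes. -/
theorem ext_cofree_eq_zero {γ : k →ₗc[k] C} {n r s : ℕ} {K : ModuleCat.{u} (DualAlgebra k C)}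
    (p : ModuleCat.of (DualAlgebra k C) (Fin r → DualAlgebra k C) ⟶ K)
    (hp : Function.Surjective p.hom)
    {ε : Ext ((inclusion k C).obj (trivialComodule γ)) K n} (hε : IsSyzygyClass ε)
    (u : Fin s → LinearMap.ker p.hom)
    (hu : Function.Surjective (Fintype.linearCombination (DualAlgebra k C) u))
    (V : Type u) [AddCommGroup V] [Module k V]
    (x : Ext ((inclusion k C).obj (trivialComodule γ)) ((inclusion k C).obj (cofree V)) (n + 1)) :
    x = 0 := by
  have hS := kerSequence_shortExact p hp
  have : Projective (kerSequence p).X₂ :=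
    inferInstanceAs (Projective (ModuleCat.of (DualAlgebra k C) (Fin r → DualAlgebra k C)))
  obtain ⟨y, rfl⟩ := (hε.comp_extClass hS _ 0 _ (add_zero _)).1 x
  obtain ⟨φ, rfl⟩ := (Ext.mk₀_bijective _ _).2 y
  have hval : ∀ f, (Fintype.linearCombination (DualAlgebra k C) u f).1
      = Fintype.linearCombination (DualAlgebra k C)
        (fun j => ((u j).1 : Fin r → DualAlgebra k C)) f := fun f => by
    rw [Fintype.linearCombination_apply, Fintype.linearCombination_apply, Submodule.coe_sum]
    rfl
  have hlin : ∀ (ψ : LinearMap.ker p.hom →ₗ[DualAlgebra k C] (inclusion k C).obj (cofree V)) f,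
      ψ (Fintype.linearCombination (DualAlgebra k C) u f)
        = ∑ j, (cofree (C := C) V).act (f j) (ψ (u j)) := fun ψ f => by
    rw [Fintype.linearCombination_apply, map_sum]
    exact Finset.sum_congr rfl fun j _ => map_smul ψ _ _
  obtain ⟨w, hw⟩ := exists_extension_cofree V (fun j => (u j).1) (fun j => φ.hom (u j))
    fun f hf => by
      have h0 : Fintype.linearCombination (DualAlgebra k C) u f = 0 :=
        Subtype.ext ((hval f).trans hf)
      rw [← hlin φ.hom, h0]
      exact map_zero φ.hom
  have hext : φ = (kerSequence p).f ≫ freeLift (cofree V) w := by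
    ext g
    obtain ⟨f, rfl⟩ := hu g
    refine (hlin φ.hom f).trans
      (Eq.trans ?_ (hlin ((kerSequence p).f ≫ freeLift (cofree V) w).hom f).symm)
    exact Finset.sum_congr rfl fun j _ => congrArg ((cofree V).act (f j)) (hw j).symm
  rw [hext]
  exact comp_extClass_comp_mk₀_eq_zero hS ε _

/-- Finite generation passes to the next syzygy, and it makes the next `Ext` from the trivial module
to cofree comodules vanish. -/
theorem HasFiniteSyzygy.succ {γ : k →ₗc[k] C} (hC : IsConilpotent γ) {n : ℕ}
    (h : HasFiniteSyzygy γ n)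
    (hn : ∀ M, Function.Surjective ((inclusion k C).mapExtAddHom (trivialComodule γ) M n))
    (hfin : FiniteDimensional k (Ext (trivialComodule γ) (trivialComodule γ) (n + 1))) :
    HasFiniteSyzygy γ (n + 1) ∧ ∀ (V : Type u) [AddCommGroup V] [Module k V]
      (x : Ext ((inclusion k C).obj (trivialComodule γ)) ((inclusion k C).obj (cofree V)) (n + 1)),
      x = 0 := by
  obtain ⟨K, ε, r, p, hε, hp⟩ := h
  obtain ⟨s, u, hu⟩ := exists_generators hC (LinearMap.ker p.hom)
    (finiteDimensional_socle γ hn hfin p hp hε)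
  refine ⟨?_, fun V _ _ x => ext_cofree_eq_zero p hp hε u hu V x⟩
  have hS := kerSequence_shortExact p hp
  have : Projective (kerSequence p).X₂ :=
    inferInstanceAs (Projective (ModuleCat.of (DualAlgebra k C) (Fin r → DualAlgebra k C)))
  exact ⟨(kerSequence p).X₁, ε.comp hS.extClass rfl, s,
    ModuleCat.ofHom (Fintype.linearCombination (DualAlgebra k C) u), hε.comp_extClass hS, hu⟩

/-- The two inductions run together: the comparison isomorphism in degree `n` is what makes the
`(n+1)`-st syzygy finitely generated, and this in turn yields the comparison in degree `n + 1`. -/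
theorem mapExt_bijective {γ : k →ₗc[k] C} (hC : IsConilpotent γ) (n : ℕ)
    (hfin : ∀ i : ℕ, 1 ≤ i → i ≤ n →
      FiniteDimensional k (Ext (trivialComodule γ) (trivialComodule γ) i)) :
    HasFiniteSyzygy γ n ∧ ∀ (L M : LeftComodule k C),
      Function.Bijective ((inclusion k C).mapExtAddHom L M n) := by
  induction n with
  | zero =>
    refine ⟨hasFiniteSyzygy_zero γ, fun L M => ?_⟩
    have h : Function.Bijective ((inclusion k C).map : (L ⟶ M) → _) :=
      ⟨(inclusion k C).map_injective, (inclusion k C).map_surjective⟩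
    simpa [Ext.mapExactFunctor₀] using h
  | succ n ih =>
    obtain ⟨hsyz, hbij⟩ := ih fun i h1 hi => hfin i h1 (hi.trans n.le_succ)
    obtain ⟨hsyz', hext⟩ := hsyz.succ hC (fun M => (hbij _ M).2) (hfin _ (by omega) le_rfl)
    refine ⟨hsyz', fun L M => ?_⟩
    have := mono_toCofree_id M
    exact mapExt_bijective_succ (inclusion k C) L n (hbij L) (toCofree M LinearMap.id)
      (ext_eq_zero_of_trivial hC n _ (hext M) L)

end Coaugmented

end

theorem mainTheorem3 (k C : Type u) [Field k] [AddCommGroup C] [Module k C] [Coalgebra k C]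
    (γ : k →ₗc[k] C) (hC : Coaugmented.IsConilpotent γ) (n : ℕ)
    (hfin : ∀ i : ℕ, 1 ≤ i → i ≤ n →
      FiniteDimensional k (Abelian.Ext
        (Coaugmented.trivialComodule γ) (Coaugmented.trivialComodule γ) i))
    (L M : LeftComodule k C) (i : ℕ) (hi : i ≤ n) :
    Function.Bijective ((LeftComodule.inclusion k C).mapExtLinearMap k L M i) :=
  (Coaugmented.mapExt_bijective hC i fun j h1 hj => hfin j h1 (hj.trans hi)).2 L M
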